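/- For $\alpha\in(0,2]$, $\sigma>0$, $\beta\in[-1,1]$, write $S\sim S_\alpha(\sigma,\beta,0)$ if the real random variable $S$ has characteristic function $\mathbb{E}[e^{itS}]=\exp\left(-|\sigma t|^\alpha(1-i\beta\,\mathrm{sign}(t)\,a)\right)$ with $a=\tan(\pi\alpha/2)$ when $\alpha\neq1$ (and $\exp\left(-|\sigma t|(1+i\beta\frac{2}{\pi}\mathrm{sign}(t)\ln|t|)\right)$ when $\alpha=1$). For $A_j,B_j>0$ and $z>0$, the Fox $H$-function is $$H^{m,n}_{p,p'}\left[z\,\middle|\,\begin{matrix}(a_1,A_1),\dots,(a_p,A_p)\\(b_1,B_1),\dots,(b_{p'},B_{p'})\end{matrix}\right]=\frac1{2\pi i}\int_C\frac{\prod_{j=1}^m\Gamma(b_j+B_js)\,\prod_{j=1}^n\Gamma(1-a_j-A_js)}{\prod_{j=m+1}^{p'}\Gamma(1-b_j-B_js)\,\prod_{j=n+1}^p\Gamma(a_j+A_js)}\,z^{-s}\,ds ,$$ where $C$ is a vertical line, directed upwards, that has the poles of $\Gamma(b_j+B_js)$, $j\le m$, on its left and those of $\Gamma(1-a_j-A_js)$,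 $j\le n$, on its right. **Theorem.** Let $1<\alpha\le2$, $\sigma>0$, $\beta\in[-1,1]$, $S\sim S_\alpha(\sigma,\beta,0)$, $q\in(0,1)$, and let $s_q=\inf\{x: P(S\le x)>q\}$ be the $q$-quantile of $S$; assume $s_q\ge0$. Put $a=\tan(\pi\alpha/2)$, $r=\sqrt{1+(a\beta)^2}$, $\phi=\arctan(a\beta)$ and $\gamma=\frac12+\frac{\phi}{\alpha\pi}$, and let $$H(z)=H^{1,1}_{2,2}\left[z\,\middle|\,\begin{matrix}(1-\frac{\alpha-1}{\alpha},\frac1\alpha),\ (\gamma,\gamma)\\(0,1),\ (\gamma,\gamma)\end{matrix}\right].$$ Then $H(z)$ is well defined for every $z>0$: $\gamma>0$, separating vertical lines exist, and along each of them the integral converges absolutely, to the same value. Moreover $S$ is integrable conditionally on $\{S>s_q\}$, and $$TCE_q[S]=\mathbb{E}[S\mid S>s_q]=\frac{\sigma r^{1/\alpha}}{1-q}\;H\!\left(\frac{s_q}{\sigma r^{1/\alpha}}\right),$$ where for $s_q=0$ the value $H(0)$ is read as the limit $\lim_{z\downarrow0}H(z)$, which exists. -/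

import Mathlib

open MeasureTheory ProbabilityTheory Filter Topology

noncomputable section

/-- The characteristic function of the stable law with tail index `α`, scale `σ`, skewness `β`
and location `μ`. -/
def stableCharFun (α σ β μ t : ℝ) : ℂ :=
  if α = 1 then
    Complex.exp (-((|σ * t| : ℝ) : ℂ) *
        (1 + Complex.I * ((β * (2 / Real.pi) * Real.sign t * Real.log |t| : ℝ) : ℂ))
      + Complex.I * ((t * μ : ℝ) : ℂ))
  else
    Complex.exp (-((|σ * t| ^ α : ℝ) : ℂ) *
        (1 - Complex.I * ((β * Real.sign t * Real.tan (Real.pi * α / 2) : ℝ) : ℂ))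
      + Complex.I * ((t * μ : ℝ) : ℂ))

/-- The random variable `X` has the stable law `S_α(σ, β, μ)`. -/
def HasStableLaw {Ω : Type*} [MeasurableSpace Ω] (P : Measure Ω) (X : Ω → ℝ) (α σ β μ : ℝ) : Prop :=
  ∀ t : ℝ, charFun (P.map X) t = stableCharFun α σ β μ t

/-- The value at risk `x_q = inf {x | F_X(x) > q}`. -/
def valueAtRisk {Ω : Type*} [MeasurableSpace Ω] (P : Measure Ω) (X : Ω → ℝ) (q : ℝ) : ℝ :=
  sInf {x : ℝ | q < cdf (P.map X) x}

/-- The law `P` conditioned on the tail event `X > x_q`. -/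
def tailMeasure {Ω : Type*} [MeasurableSpace Ω] (P : Measure Ω) (X : Ω → ℝ) (q : ℝ) : Measure Ω :=
  ProbabilityTheory.cond P {ω | valueAtRisk P X q < X ω}

/-- The tail conditional expectation `E[X | X > x_q]`. -/
def tailCondExp {Ω : Type*} [MeasurableSpace Ω] (P : Measure Ω) (X : Ω → ℝ) (q : ℝ) : ℝ :=
  ∫ ω, X ω ∂(tailMeasure P X q)

/-- The Mellin-Barnes kernel of the Fox function `H^{k,l}_{m,n}` with upper parameters
`(a_j, A_j)` and lower parameters `(b_j, B_j)`. Lists are indexed from `0`, so "the first `k`" is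
`j < k`. -/
def foxKernel (k l : ℕ) {m n : ℕ} (a : Fin m → ℂ) (A : Fin m → ℝ) (b : Fin n → ℂ) (B : Fin n → ℝ)
    (s : ℂ) : ℂ :=
  ((∏ j : Fin n with j.val < k, Complex.Gamma (b j + B j * s)) *
      (∏ j : Fin m with j.val < l, Complex.Gamma (1 - a j - A j * s))) /
    ((∏ j : Fin n with k ≤ j.val, Complex.Gamma (1 - b j - B j * s)) *
      (∏ j : Fin m with l ≤ j.val, Complex.Gamma (a j + A j * s)))

/-- The vertical line `Re s = c` separates the two families of poles of the numerator of the
kernel: the poles `s = -(b_j + i) / B_j` lie to its left, and the poles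
`s = (1 - a_j + i) / A_j` to its right, for `i = 0, 1, 2, …`. -/
def FoxSeparates (k l : ℕ) {m n : ℕ} (a : Fin m → ℂ) (A : Fin m → ℝ) (b : Fin n → ℂ)
    (B : Fin n → ℝ) (c : ℝ) : Prop :=
  (∀ j : Fin n, j.val < k → ∀ i : ℕ, -((b j).re + i) / B j < c) ∧
  (∀ j : Fin m, j.val < l → ∀ i : ℕ, c < (1 - (a j).re + i) / A j)

/-- `h` is the value at `z > 0` of the Fox function `H^{k,l}_{m,n}`: the parameters are admissible,
some vertical line separates the poles, and along each such line `C` the integral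
`(1 / 2πi) ∫_C kernel(s) z^{-s} ds`, which is the inverse Mellin transform of the kernel,
converges absolutely to `h`. -/
structure HasFoxH (k l : ℕ) {m n : ℕ} (a : Fin m → ℂ) (A : Fin m → ℝ) (b : Fin n → ℂ)
    (B : Fin n → ℝ) (z : ℝ) (h : ℂ) : Prop where
  le_lower : k ≤ n
  le_upper : l ≤ m
  upper_pos : ∀ j, 0 < A j
  lower_pos : ∀ j, 0 < B j
  arg_pos : 0 < z
  exists_line : ∃ c : ℝ, FoxSeparates k l a A b B c
  integrable : ∀ c : ℝ, FoxSeparates k l a A b B c →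
    Complex.VerticalIntegrable (foxKernel k l a A b B) c
  value : ∀ c : ℝ, FoxSeparates k l a A b B c → mellinInv c (foxKernel k l a A b B) z = h

open Classical in
/-- The Fox function `H^{k,l}_{m,n}` at `z` (with the value `0` where it is not defined). -/
def foxH (k l : ℕ) {m n : ℕ} (a : Fin m → ℂ) (A : Fin m → ℝ) (b : Fin n → ℂ) (B : Fin n → ℝ)
    (z : ℝ) : ℂ :=
  if hz : ∃ h : ℂ, HasFoxH k l a A b B z h then hz.choose else 0

theorem HasFoxH.foxH_eq {k l m n : ℕ} {a : Fin m → ℂ} {A : Fin m → ℝ} {b : Fin n → ℂ}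
    {B : Fin n → ℝ} {z : ℝ} {h : ℂ} (hh : HasFoxH k l a A b B z h) :
    foxH k l a A b B z = h := by
  have hz : ∃ h : ℂ, HasFoxH k l a A b B z h := ⟨h, hh⟩
  obtain ⟨c, hc⟩ := hh.exists_line
  unfold foxH
  rw [dif_pos hz, ← hz.choose_spec.value c hc, hh.value c hc]

end

/-! ### The Gamma integral with a complex rate -/

/-! Dividing `S` by `k = σ r^(1/α)` gives a law `ν` with characteristic function `exp(-e^{-iφ} t^α)`
for `t > 0`, because `1 - i aβ = r e^{-iφ}`. With `L(z) = ∫_{y > z} y dν`, the tail expectation is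
`k L(s_q / k) / (1 - q)`, so the theorem reduces to `L = H` on `z > 0`, which is an instance of
Mellin inversion.

By Fubini the Mellin transform of `L` at `s` is `s⁻¹ E[Y₊^{s+1}]`, where `Y` has law `ν` and `0 < Re
s < α - 1`. The moment `E[Y₊^w]`, `1 < Re w < α`, comes from the twice regularised Gamma integral `∫
(e^{-lt} - 1 + lt) t^{-w-1} dt = Γ(-w) l^w` at `l = ∓iy`. Integrating over `ν` removes the linear
term, as the mean is zero, and leaves an integral of `charFun ν (±t) - 1`. Substituting `u = t^α`
evaluates it by the once regularised Gamma integral. A combination of the two signs cancels the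
negative half line (`integral_pos_part_cpow`), and the reflection formula identifies the outcome
with the Fox kernel (`foxKernel_eq`).

Inversion needs the kernel to be integrable on vertical lines (`verticalIntegrable_foxKernel`, from
exponential decay of Gamma and `γ ≤ 1/α < 1`) and `L` to be continuous. The latter holds because an
integrable characteristic function excludes atoms; this also gives `P(S > s_q) = 1 - q` and the
limit at `0`. -/

theorem integrableOn_cpow_mul_exp_neg_mul {a l : ℂ} (ha : 0 < a.re) (hl : 0 < l.re) :
    IntegrableOn (fun t : ℝ => (t : ℂ) ^ (a - 1) * Complex.exp (-(l * t))) (Set.Ioi 0) := by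
  have h : IntegrableOn (fun t : ℝ => t ^ (a.re - 1) * Real.exp (-l.re * t ^ (1 : ℝ)))
      (Set.Ioi 0) := integrableOn_rpow_mul_exp_neg_mul_rpow (by linarith) one_pos hl
  refine Integrable.mono' h (by fun_prop) ?_
  refine (ae_restrict_iff' measurableSet_Ioi).mpr (Eventually.of_forall fun t (ht : 0 < t) => ?_)
  rw [norm_mul, Complex.norm_cpow_eq_rpow_re_of_pos ht, Complex.norm_exp, Real.rpow_one]
  simp

theorem differentiableAt_integral_cpow_mul_exp_neg_mul {a l : ℂ} (ha : 0 < a.re) (hl : 0 < l.re) :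
    DifferentiableAt ℂ
      (fun l : ℂ => ∫ t : ℝ in Set.Ioi 0, (t : ℂ) ^ (a - 1) * Complex.exp (-(l * t))) l := by
  -- On this half-plane the derivative of the integrand is dominated with the fixed rate `l.re / 2`.
  have hs : {z : ℂ | l.re / 2 < z.re} ∈ 𝓝 l :=
    (isOpen_lt continuous_const Complex.continuous_re).mem_nhds (by simp; linarith)
  have h : IntegrableOn (fun t : ℝ => t ^ a.re * Real.exp (-(l.re / 2) * t ^ (1 : ℝ)))
      (Set.Ioi 0) := integrableOn_rpow_mul_exp_neg_mul_rpow (by linarith) one_pos (by linarith)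
  refine (hasDerivAt_integral_of_dominated_loc_of_deriv_le (μ := volume.restrict (Set.Ioi 0))
    (F := fun (l : ℂ) (t : ℝ) => (t : ℂ) ^ (a - 1) * Complex.exp (-(l * t)))
    (F' := fun (l : ℂ) (t : ℝ) => (t : ℂ) ^ (a - 1) * (Complex.exp (-(l * t)) * -t)) hs
    (Eventually.of_forall fun z => by fun_prop) (integrableOn_cpow_mul_exp_neg_mul ha hl)
    (by fun_prop) ?_ h (Eventually.of_forall fun t z _ => ?_)).2.differentiableAt
  · refine (ae_restrict_iff' measurableSet_Ioi).mpr
      (Eventually.of_forall fun t (ht : 0 < t) z (hz : l.re / 2 < z.re) => ?_)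
    rw [norm_mul, norm_mul, Complex.norm_cpow_eq_rpow_re_of_pos ht, Complex.norm_exp, norm_neg,
      Complex.norm_real, Real.norm_of_nonneg ht.le, mul_comm (Real.exp _), ← mul_assoc,
      Complex.sub_re, Complex.one_re, Real.rpow_sub_one ht.ne', div_mul_cancel₀ _ ht.ne',
      Real.rpow_one]
    gcongr
    simp only [Complex.neg_re, Complex.re_mul_ofReal]
    nlinarith
  · have h1 : HasDerivAt (fun l : ℂ => -(l * (t : ℂ))) (-(t : ℂ)) z := by
      simpa using ((hasDerivAt_id z).mul_const (t : ℂ)).fun_neg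
    exact h1.cexp.const_mul _

/-- Identity theorem in `l`: both sides are analytic on the right half-plane and agree at the real
points `1 + 1/(n+1)`, which accumulate at `1`. -/
theorem integral_cpow_mul_exp_neg_mul {a l : ℂ} (ha : 0 < a.re) (hl : 0 < l.re) :
    ∫ t : ℝ in Set.Ioi 0, (t : ℂ) ^ (a - 1) * Complex.exp (-(l * t)) =
      l ^ (-a) * Complex.Gamma a := by
  have hU : IsOpen {z : ℂ | 0 < z.re} := isOpen_lt continuous_const Complex.continuous_re
  have h1 : AnalyticOnNhd ℂ
      (fun l : ℂ => ∫ t : ℝ in Set.Ioi 0, (t : ℂ) ^ (a - 1) * Complex.exp (-(l * t)))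
      {z : ℂ | 0 < z.re} := DifferentiableOn.analyticOnNhd (fun z hz =>
        (differentiableAt_integral_cpow_mul_exp_neg_mul ha hz).differentiableWithinAt) hU
  have h2 : AnalyticOnNhd ℂ (fun l : ℂ => l ^ (-a) * Complex.Gamma a) {z : ℂ | 0 < z.re} :=
    DifferentiableOn.analyticOnNhd (fun z (hz : 0 < z.re) =>
      ((differentiableAt_id.cpow_const (Or.inl hz)).mul_const _).differentiableWithinAt) hU
  have hconv : IsPreconnected {z : ℂ | 0 < z.re} := (convex_halfSpace_re_gt 0).isPreconnected
  refine h1.eqOn_of_preconnected_of_frequently_eq h2 hconv (z₀ := 1) (by simp) ?_ hl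
  have hseq : Tendsto (fun n : ℕ => ((1 + 1 / ((n : ℝ) + 1) : ℝ) : ℂ)) atTop (𝓝[≠] 1) := by
    refine tendsto_nhdsWithin_iff.mpr ⟨?_, Eventually.of_forall fun n => ?_⟩
    · have := tendsto_one_div_add_atTop_nhds_zero_nat (𝕜 := ℝ)
      have h3 := (Complex.continuous_ofReal.tendsto _).comp (this.const_add 1)
      simpa [Function.comp_def] using h3
    · have : (0 : ℝ) < 1 / ((n : ℝ) + 1) := by positivity
      simp only [Set.mem_compl_iff, Set.mem_singleton_iff]
      intro h
      have : (1 + 1 / ((n : ℝ) + 1) : ℝ) = 1 := by exact_mod_cast h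
      linarith
  refine hseq.frequently (Frequently.of_forall fun n => ?_)
  have hr : (0 : ℝ) < 1 + 1 / ((n : ℝ) + 1) := by positivity
  rw [Complex.integral_cpow_mul_exp_neg_mul_Ioi ha hr, one_div, Complex.inv_cpow, Complex.cpow_neg]
  rw [Complex.arg_ofReal_of_nonneg hr.le]
  exact Real.pi_pos.ne

/-- With rate `l = e^{iθ}` the factor `l^{-s}` has norm `e^{θ Im s}`, while the integral is at most
the real Gamma integral with rate `cos θ`. -/
theorem norm_Gamma_mul_exp_le {s : ℂ} {θ : ℝ} (hs : 0 < s.re) (hθ : |θ| < Real.pi / 2) :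
    ‖Complex.Gamma s‖ * Real.exp (θ * s.im) ≤
      (Real.cos θ)⁻¹ ^ s.re * Real.Gamma s.re := by
  have hcos : 0 < Real.cos θ := Real.cos_pos_of_mem_Ioo ⟨by linarith [neg_abs_le θ],
    by linarith [le_abs_self θ]⟩
  set l : ℂ := Complex.exp (θ * Complex.I) with hl
  have hlre : l.re = Real.cos θ := Complex.exp_ofReal_mul_I_re θ
  have h := integral_cpow_mul_exp_neg_mul (l := l) hs (by rwa [hlre])
  have hpow : ‖l ^ (-s)‖ = Real.exp (θ * s.im) := by
    have hlog : Complex.log l = θ * Complex.I := by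
      rw [hl, Complex.log_exp] <;> simp <;>
        linarith [Real.pi_pos, neg_abs_le θ, le_abs_self θ]
    rw [Complex.cpow_def_of_ne_zero (Complex.exp_ne_zero _), hlog, Complex.norm_exp]
    simp
  have h2 : ‖Complex.Gamma s‖ * Real.exp (θ * s.im) =
      ‖∫ t : ℝ in Set.Ioi 0, (t : ℂ) ^ (s - 1) * Complex.exp (-(l * t))‖ := by
    rw [h, norm_mul, hpow, mul_comm]
  rw [h2, ← one_div, ← Real.integral_rpow_mul_exp_neg_mul_Ioi hs hcos]
  refine (norm_integral_le_integral_norm _).trans (le_of_eq ?_)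
  refine setIntegral_congr_fun measurableSet_Ioi fun t (ht : 0 < t) => ?_
  simp only [norm_mul, Complex.norm_cpow_eq_rpow_re_of_pos ht, Complex.norm_exp]
  simp [hlre]

theorem exists_norm_Gamma_le (c θ : ℝ) (hc : 0 < c) (h0 : 0 ≤ θ) (hθ : θ < Real.pi / 2) :
    ∃ C : ℝ, ∀ s : ℂ, s.re = c → ‖Complex.Gamma s‖ ≤ C * Real.exp (-θ * |s.im|) := by
  refine ⟨(Real.cos θ)⁻¹ ^ c * Real.Gamma c, fun s hs => ?_⟩
  rw [neg_mul, Real.exp_neg, ← div_eq_mul_inv, le_div_iff₀ (Real.exp_pos _)]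
  rcases abs_cases s.im with h | h
  · rw [h.1, ← hs]
    exact norm_Gamma_mul_exp_le (hs ▸ hc) (by rwa [abs_of_nonneg h0])
  · rw [h.1, ← hs, ← Real.cos_neg θ, mul_neg, ← neg_mul]
    exact norm_Gamma_mul_exp_le (hs ▸ hc) (by rwa [abs_neg, abs_of_nonneg h0])

/-! ### Regularised Gamma integrals -/

/-- The common shape of the majorants below: one power near zero, another near infinity. -/
theorem integrableOn_ite_rpow {a b : ℝ} (ha : -1 < a) (hb : b < -1) :
    IntegrableOn (fun t : ℝ => if t ≤ 1 then t ^ a else t ^ b) (Set.Ioi 0) := by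
  rw [← Set.Ioc_union_Ioi_eq_Ioi (zero_le_one (α := ℝ)), integrableOn_union]
  constructor
  · refine IntegrableOn.congr_fun (f := fun t : ℝ => t ^ a) ?_
      (fun t ht => by simp [ht.2]) measurableSet_Ioc
    rw [integrableOn_Ioc_iff_integrableOn_Ioo]
    exact (intervalIntegral.integrableOn_Ioo_rpow_iff one_pos).mpr ha
  · exact (integrableOn_Ioi_rpow_of_lt hb one_pos).congr_fun
      (fun t (ht : 1 < t) => by simp [not_le.mpr ht]) measurableSet_Ioi

/-- Mean value inequality on the convex half-plane `Re z ≤ 0`, where the derivative of `exp` has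
norm at most `1`. -/
theorem norm_exp_sub_one_le_norm {z : ℂ} (hz : z.re ≤ 0) : ‖Complex.exp z - 1‖ ≤ ‖z‖ := by
  have h := Convex.norm_image_sub_le_of_norm_hasDerivWithin_le (f := Complex.exp)
    (f' := Complex.exp) (s := {z : ℂ | z.re ≤ 0}) (x := 0) (y := z) (C := 1)
    (fun x _ => (Complex.hasDerivAt_exp x).hasDerivWithinAt)
    (fun x hx => by rw [Complex.norm_exp]; exact Real.exp_le_one_iff.mpr hx)
    (convex_halfSpace_re_le 0) (by simp) hz
  simpa using h

theorem norm_exp_sub_one_le_two {z : ℂ} (hz : z.re ≤ 0) : ‖Complex.exp z - 1‖ ≤ 2 := by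
  refine (norm_sub_le _ _).trans ?_
  rw [Complex.norm_exp, norm_one]
  linarith [Real.exp_le_one_iff.mpr hz]

theorem norm_exp_sub_one_sub_le_norm {z : ℂ} (hz : z.re ≤ 0) :
    ‖Complex.exp z - 1 - z‖ ≤ 2 * ‖z‖ := by
  refine (norm_sub_le _ _).trans ?_
  linarith [norm_exp_sub_one_le_norm hz]

theorem norm_exp_sub_one_sub_le_sq {z : ℂ} (hz : z.re ≤ 0) :
    ‖Complex.exp z - 1 - z‖ ≤ 2 * ‖z‖ ^ 2 := by
  rcases le_total ‖z‖ 1 with h | h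
  · have := Complex.norm_exp_sub_one_sub_id_le h
    nlinarith [sq_nonneg ‖z‖]
  · have := norm_exp_sub_one_sub_le_norm hz
    nlinarith

theorem re_neg_mul_ofReal_nonpos {l : ℂ} {t : ℝ} (hl : 0 ≤ l.re) (ht : 0 ≤ t) :
    (-(l * t)).re ≤ 0 := by
  simp only [Complex.neg_re, Complex.re_mul_ofReal]
  nlinarith

/-- The bound depends on `l` only through `K`, so that it can dominate a limit in `l`. -/
theorem norm_exp_sub_one_mul_cpow_le {l v : ℂ} {K t : ℝ} (hl : 0 ≤ l.re) (hlK : ‖l‖ ≤ K)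
    (hK : 2 ≤ K) (ht : 0 < t) :
    ‖(Complex.exp (-(l * t)) - 1) * (t : ℂ) ^ (-v - 1)‖ ≤
      K * if t ≤ 1 then t ^ (-v.re) else t ^ (-v.re - 1) := by
  have hre := re_neg_mul_ofReal_nonpos hl ht.le
  rw [norm_mul, Complex.norm_cpow_eq_rpow_re_of_pos ht, Complex.sub_re, Complex.neg_re,
    Complex.one_re]
  split_ifs with h
  · calc _ ≤ (K * t) * t ^ (-v.re - 1) := by
          gcongr
          refine (norm_exp_sub_one_le_norm hre).trans ?_
          rw [norm_neg, norm_mul, Complex.norm_real, Real.norm_of_nonneg ht.le]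
          gcongr
      _ = K * t ^ (-v.re) := by
          rw [Real.rpow_sub_one ht.ne']
          field_simp
  · gcongr
    exact (norm_exp_sub_one_le_two hre).trans hK

theorem norm_exp_sub_one_sub_mul_cpow_le {l w : ℂ} {K t : ℝ} (hl : 0 ≤ l.re) (hlK : ‖l‖ ≤ K)
    (hK : 1 ≤ K) (ht : 0 < t) :
    ‖(Complex.exp (-(l * t)) - 1 + l * t) * (t : ℂ) ^ (-w - 1)‖ ≤
      2 * K ^ 2 * if t ≤ 1 then t ^ (1 - w.re) else t ^ (-w.re) := by
  have hre := re_neg_mul_ofReal_nonpos hl ht.le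
  have hn : ‖-(l * (t : ℂ))‖ ≤ K * t := by
    rw [norm_neg, norm_mul, Complex.norm_real, Real.norm_of_nonneg ht.le]
    gcongr
  rw [norm_mul, Complex.norm_cpow_eq_rpow_re_of_pos ht, Complex.sub_re, Complex.neg_re,
    Complex.one_re, ← sub_neg_eq_add (Complex.exp _ - 1)]
  have e1 : t ^ (-w.re - 1) = t ^ (-w.re) / t := Real.rpow_sub_one ht.ne' _
  have e2 : t ^ (1 - w.re) = t ^ (-w.re) * t := by
    rw [show 1 - w.re = -w.re + 1 by ring, Real.rpow_add_one ht.ne']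
  split_ifs with h
  · calc _ ≤ (2 * (K * t) ^ 2) * t ^ (-w.re - 1) := by
          gcongr
          exact (norm_exp_sub_one_sub_le_sq hre).trans (by gcongr)
      _ = _ := by
          rw [e1, e2]
          field_simp
  · calc _ ≤ (2 * (K * t)) * t ^ (-w.re - 1) := by
          gcongr
          exact (norm_exp_sub_one_sub_le_norm hre).trans (by gcongr)
      _ = 2 * K * t ^ (-w.re) := by
          rw [e1]
          field_simp
      _ ≤ _ := by
          gcongr
          nlinarith

theorem integrableOn_exp_sub_one_mul_cpow {l v : ℂ} (hl : 0 ≤ l.re) (hv0 : 0 < v.re)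
    (hv1 : v.re < 1) :
    IntegrableOn (fun t : ℝ => (Complex.exp (-(l * t)) - 1) * (t : ℂ) ^ (-v - 1)) (Set.Ioi 0) :=
  Integrable.mono' ((integrableOn_ite_rpow (a := -v.re) (b := -v.re - 1) (by linarith)
    (by linarith)).const_mul (max ‖l‖ 2)) (by fun_prop)
    ((ae_restrict_iff' measurableSet_Ioi).mpr (Eventually.of_forall fun _ ht =>
      norm_exp_sub_one_mul_cpow_le hl (le_max_left _ _) (le_max_right _ _) ht))

theorem integrableOn_exp_sub_one_sub_mul_cpow {l w : ℂ} (hl : 0 ≤ l.re) (hw1 : 1 < w.re)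
    (hw2 : w.re < 2) :
    IntegrableOn (fun t : ℝ => (Complex.exp (-(l * t)) - 1 + l * t) * (t : ℂ) ^ (-w - 1))
      (Set.Ioi 0) :=
  Integrable.mono' ((integrableOn_ite_rpow (a := 1 - w.re) (b := -w.re) (by linarith)
    (by linarith)).const_mul (2 * (max ‖l‖ 1) ^ 2)) (by fun_prop)
    ((ae_restrict_iff' measurableSet_Ioi).mpr (Eventually.of_forall fun _ ht =>
      norm_exp_sub_one_sub_mul_cpow_le hl (le_max_left _ _) (le_max_right _ _) ht))

/-- Integration by parts; each use lowers the number of subtracted Taylor terms by one. -/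
theorem integral_mul_cpow_neg_sub_one {g g' : ℝ → ℂ} {w : ℂ} (hw : w ≠ 0)
    (hg : ∀ t : ℝ, 0 < t → HasDerivAt g (g' t) t)
    (hi : IntegrableOn (fun t : ℝ => g t * (t : ℂ) ^ (-w - 1)) (Set.Ioi 0))
    (hi' : IntegrableOn (fun t : ℝ => g' t * (t : ℂ) ^ (-w)) (Set.Ioi 0))
    (h0 : Tendsto (fun t : ℝ => g t * (t : ℂ) ^ (-w)) (𝓝[>] 0) (𝓝 0))
    (htop : Tendsto (fun t : ℝ => g t * (t : ℂ) ^ (-w)) atTop (𝓝 0)) :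
    ∫ t : ℝ in Set.Ioi 0, g t * (t : ℂ) ^ (-w - 1) =
      1 / w * ∫ t : ℝ in Set.Ioi 0, g' t * (t : ℂ) ^ (-w) := by
  have hv : ∀ t ∈ Set.Ioi (0 : ℝ),
      HasDerivAt (fun t : ℝ => (t : ℂ) ^ (-w) / (-w)) ((t : ℂ) ^ (-w - 1)) t := fun t ht => by
    have := hasDerivAt_ofReal_cpow_const' (x := t) (ne_of_gt ht) (r := -w - 1)
      (by intro h; apply hw; linear_combination -h)
    simpa using this
  have e : ∀ f : ℝ → ℂ, (f * fun t : ℝ => (t : ℂ) ^ (-w) / (-w)) =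
      fun t : ℝ => (f t * (t : ℂ) ^ (-w)) * (-w)⁻¹ := fun f => by
    ext t
    simp only [Pi.mul_apply]
    ring
  rw [integral_Ioi_mul_deriv_eq_deriv_mul (u := g) (u' := g') (a' := 0) (b' := 0) hg hv hi
    (by rw [e]; exact hi'.mul_const _) (by rw [e]; simpa using h0.mul_const (-w)⁻¹)
    (by rw [e]; simpa using htop.mul_const (-w)⁻¹), ← integral_const_mul, sub_zero, zero_sub,
    ← integral_neg]
  refine integral_congr_ae (Eventually.of_forall fun t => ?_)
  simp only
  field_simp

theorem tendsto_const_mul_rpow_nhdsGT_zero {a : ℝ} (C : ℝ) (ha : 0 < a) :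
    Tendsto (fun t : ℝ => C * t ^ a) (𝓝[>] 0) (𝓝 0) := by
  have h := (Real.continuousAt_rpow_const 0 a (Or.inr ha.le)).tendsto
  rw [Real.zero_rpow ha.ne'] at h
  simpa using (h.mono_left nhdsWithin_le_nhds).const_mul C

theorem tendsto_const_mul_rpow_neg_atTop {a : ℝ} (C : ℝ) (ha : 0 < a) :
    Tendsto (fun t : ℝ => C * t ^ (-a)) atTop (𝓝 0) := by
  simpa using (tendsto_rpow_neg_atTop ha).const_mul C

theorem tendsto_mul_cpow_zero {g : ℝ → ℂ} {w : ℂ} {l : Filter ℝ} {B : ℝ → ℝ}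
    (hpos : ∀ᶠ t in l, 0 < t) (hg : ∀ᶠ t in l, 0 < t → ‖g t‖ * t ^ w.re ≤ B t)
    (hB : Tendsto B l (𝓝 0)) : Tendsto (fun t : ℝ => g t * (t : ℂ) ^ w) l (𝓝 0) := by
  refine squeeze_zero_norm' ?_ hB
  filter_upwards [hpos, hg] with t ht h
  rw [norm_mul, Complex.norm_cpow_eq_rpow_re_of_pos ht]
  exact h ht

theorem hasDerivAt_exp_neg_mul_ofReal (l : ℂ) (t : ℝ) :
    HasDerivAt (fun t : ℝ => Complex.exp (-(l * t))) (-l * Complex.exp (-(l * t))) t := by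
  have h1 : HasDerivAt (fun t : ℝ => -(l * (t : ℂ))) (-l) t := by
    simpa using ((Complex.ofRealCLM.hasDerivAt (x := t)).const_mul l).fun_neg
  simpa [mul_comm] using h1.cexp

theorem integral_exp_sub_one_mul_cpow_of_re_pos {l v : ℂ} (hl : 0 < l.re) (hv0 : 0 < v.re)
    (hv1 : v.re < 1) :
    ∫ t : ℝ in Set.Ioi 0, (Complex.exp (-(l * t)) - 1) * (t : ℂ) ^ (-v - 1) =
      Complex.Gamma (-v) * l ^ v := by
  have hv : v ≠ 0 := fun h => by simp [h] at hv0
  have hl0 : l ≠ 0 := fun h => by simp [h] at hl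
  have h1v : 0 < (1 - v).re := by simp; linarith
  have hI := integrableOn_cpow_mul_exp_neg_mul h1v hl
  have hG := integral_cpow_mul_exp_neg_mul h1v hl
  rw [show 1 - v - 1 = -v by ring] at hI hG
  have e : (fun t : ℝ => -l * Complex.exp (-(l * t)) * (t : ℂ) ^ (-v)) =
      fun t : ℝ => -l * ((t : ℂ) ^ (-v) * Complex.exp (-(l * t))) := by
    ext t; ring
  rw [integral_mul_cpow_neg_sub_one hv
    (fun t _ => (hasDerivAt_exp_neg_mul_ofReal l t).sub_const 1)
    (integrableOn_exp_sub_one_mul_cpow hl.le hv0 hv1) (by rw [e]; exact hI.const_mul _) ?_ ?_, e,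
    integral_const_mul, hG]
  · have hΓ := Complex.Gamma_add_one (-v) (neg_ne_zero.mpr hv)
    rw [show -v + 1 = 1 - v by ring] at hΓ
    rw [hΓ, show -(1 - v) = v - 1 by ring, Complex.cpow_sub _ _ hl0, Complex.cpow_one]
    field_simp
  · refine tendsto_mul_cpow_zero self_mem_nhdsWithin (Eventually.of_forall fun t ht => ?_)
      (tendsto_const_mul_rpow_nhdsGT_zero (a := 1 - v.re) ‖l‖ (by linarith))
    rw [Complex.neg_re, show 1 - v.re = -v.re + 1 by ring, Real.rpow_add_one ht.ne',
      mul_comm (t ^ (-v.re)), ← mul_assoc]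
    gcongr
    refine (norm_exp_sub_one_le_norm (re_neg_mul_ofReal_nonpos hl.le ht.le)).trans ?_
    rw [norm_neg, norm_mul, Complex.norm_real, Real.norm_of_nonneg ht.le]
  · refine tendsto_mul_cpow_zero (eventually_gt_atTop 0) (Eventually.of_forall fun t ht => ?_)
      (tendsto_const_mul_rpow_neg_atTop 2 hv0)
    rw [Complex.neg_re]
    gcongr
    exact norm_exp_sub_one_le_two (re_neg_mul_ofReal_nonpos hl.le ht.le)

/-- Extends the formula to the imaginary axis, where characteristic functions live: replace `l` by
`l + e` and let `e ↓ 0` by dominated convergence. The power is continuous there, since `l` lies in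
the slit plane. -/
theorem integral_exp_sub_one_mul_cpow {l v : ℂ} (hl : 0 ≤ l.re) (hl0 : l ≠ 0) (hv0 : 0 < v.re)
    (hv1 : v.re < 1) :
    ∫ t : ℝ in Set.Ioi 0, (Complex.exp (-(l * t)) - 1) * (t : ℂ) ^ (-v - 1) =
      Complex.Gamma (-v) * l ^ v := by
  have hslit : l ∈ Complex.slitPlane := by
    rcases hl.lt_or_eq with h | h
    · exact Or.inl h
    · exact Or.inr fun h' => hl0 (Complex.ext h.symm h')
  have hlim : Tendsto (fun e : ℝ => l + (e : ℂ)) (𝓝[>] 0) (𝓝 l) := by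
    have : Continuous fun e : ℝ => l + (e : ℂ) := by fun_prop
    have h := this.tendsto 0
    simp only [Complex.ofReal_zero, add_zero] at h
    exact h.mono_left nhdsWithin_le_nhds
  have h1 : Tendsto (fun e : ℝ => ∫ t : ℝ in Set.Ioi 0,
      (Complex.exp (-((l + e) * t)) - 1) * (t : ℂ) ^ (-v - 1)) (𝓝[>] 0)
      (𝓝 (∫ t : ℝ in Set.Ioi 0, (Complex.exp (-(l * t)) - 1) * (t : ℂ) ^ (-v - 1))) := by
    refine tendsto_integral_filter_of_dominated_convergence
      (fun t => (‖l‖ + 2) * if t ≤ 1 then t ^ (-v.re) else t ^ (-v.re - 1))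
      (Eventually.of_forall fun e => by fun_prop) ?_
      ((integrableOn_ite_rpow (by linarith) (by linarith)).const_mul _)
      (Eventually.of_forall fun t => ?_)
    · have h2 : ∀ᶠ e : ℝ in 𝓝[>] 0, e < 1 := nhdsWithin_le_nhds (gt_mem_nhds one_pos)
      filter_upwards [h2, self_mem_nhdsWithin] with e he (he0 : 0 < e)
      refine (ae_restrict_iff' measurableSet_Ioi).mpr (Eventually.of_forall fun t ht => ?_)
      refine norm_exp_sub_one_mul_cpow_le (by simp; linarith) ?_ (by linarith [norm_nonneg l]) ht
      refine (norm_add_le _ _).trans ?_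
      rw [Complex.norm_real, Real.norm_of_nonneg he0.le]
      linarith
    · have hc : Continuous fun z : ℂ => (Complex.exp (-(z * t)) - 1) * (t : ℂ) ^ (-v - 1) := by
        fun_prop
      exact (hc.tendsto l).comp hlim
  have h2 : Tendsto (fun e : ℝ => Complex.Gamma (-v) * (l + e) ^ v) (𝓝[>] 0)
      (𝓝 (Complex.Gamma (-v) * l ^ v)) :=
    ((continuousAt_cpow_const hslit).tendsto.comp hlim).const_mul _
  refine tendsto_nhds_unique (h1.congr' ?_) h2
  filter_upwards [self_mem_nhdsWithin] with e (he : 0 < e)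
  exact integral_exp_sub_one_mul_cpow_of_re_pos (by simp; linarith) hv0 hv1

theorem integral_exp_sub_one_sub_mul_cpow {l w : ℂ} (hl : 0 ≤ l.re) (hl0 : l ≠ 0)
    (hw1 : 1 < w.re) (hw2 : w.re < 2) :
    ∫ t : ℝ in Set.Ioi 0, (Complex.exp (-(l * t)) - 1 + l * t) * (t : ℂ) ^ (-w - 1) =
      Complex.Gamma (-w) * l ^ w := by
  have hw : w ≠ 0 := fun h => by norm_num [h] at hw1
  have hI := integrableOn_exp_sub_one_mul_cpow hl (v := w - 1) (by simp; linarith)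
    (by simp; linarith)
  have hG := integral_exp_sub_one_mul_cpow hl hl0 (v := w - 1) (by simp; linarith)
    (by simp; linarith)
  rw [show -(w - 1) - 1 = -w by ring] at hI hG
  have e : (fun t : ℝ => (-l * Complex.exp (-(l * t)) + l) * (t : ℂ) ^ (-w)) =
      fun t : ℝ => -l * ((Complex.exp (-(l * t)) - 1) * (t : ℂ) ^ (-w)) := by
    ext t; ring
  have hd : ∀ t : ℝ, HasDerivAt (fun t : ℝ => l * (t : ℂ)) l t := fun t => by
    simpa using (Complex.ofRealCLM.hasDerivAt (x := t)).const_mul l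
  rw [integral_mul_cpow_neg_sub_one hw
    (fun t _ => ((hasDerivAt_exp_neg_mul_ofReal l t).sub_const 1).fun_add (hd t))
    (integrableOn_exp_sub_one_sub_mul_cpow hl hw1 hw2) (by rw [e]; exact hI.const_mul _) ?_ ?_, e,
    integral_const_mul, hG]
  · have hΓ := Complex.Gamma_add_one (-w) (neg_ne_zero.mpr hw)
    rw [show -w + 1 = -(w - 1) by ring] at hΓ
    rw [hΓ, Complex.cpow_sub _ _ hl0, Complex.cpow_one]
    field_simp
  all_goals simp only [← sub_neg_eq_add (_ - (1 : ℂ))]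
  · refine tendsto_mul_cpow_zero self_mem_nhdsWithin (Eventually.of_forall fun t ht => ?_)
      (tendsto_const_mul_rpow_nhdsGT_zero (a := 2 - w.re) (2 * ‖l‖ ^ 2) (by linarith))
    rw [Complex.neg_re, show 2 - w.re = -w.re + 1 + 1 by ring, Real.rpow_add_one ht.ne',
      Real.rpow_add_one ht.ne']
    calc _ ≤ (2 * (‖l‖ * t) ^ 2) * t ^ (-w.re) := by
          gcongr
          refine (norm_exp_sub_one_sub_le_sq (re_neg_mul_ofReal_nonpos hl ht.le)).trans ?_
          rw [norm_neg, norm_mul, Complex.norm_real, Real.norm_of_nonneg ht.le]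
      _ = _ := by ring
  · refine tendsto_mul_cpow_zero (eventually_gt_atTop 0) (Eventually.of_forall fun t ht => ?_)
      (tendsto_const_mul_rpow_neg_atTop (a := w.re - 1) (2 * ‖l‖) (by linarith))
    rw [Complex.neg_re, show -(w.re - 1) = -w.re + 1 by ring, Real.rpow_add_one ht.ne']
    calc _ ≤ (2 * (‖l‖ * t)) * t ^ (-w.re) := by
          gcongr
          refine (norm_exp_sub_one_sub_le_norm (re_neg_mul_ofReal_nonpos hl ht.le)).trans ?_
          rw [norm_neg, norm_mul, Complex.norm_real, Real.norm_of_nonneg ht.le]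
      _ = _ := by ring

/-! ### Moments and atoms from the characteristic function -/

/-- The truncation inequality bounds the tail by an integral of `1 - charFun ν` over `|t| ≤ 2/r`. -/
theorem measureReal_abs_gt_le_of_norm_one_sub_charFun_le {ν : Measure ℝ} [IsProbabilityMeasure ν]
    {α : ℝ} (hα : 0 ≤ α) (h : ∀ t : ℝ, ‖1 - charFun ν t‖ ≤ |t| ^ α) {r : ℝ} (hr : 0 < r) :
    ν.real {x | r < |x|} ≤ 2 * 2 ^ α * r ^ (-α) := by
  refine (measureReal_abs_gt_le_integral_charFun hr).trans ?_
  have h1 : ‖∫ t in (-2 * r⁻¹)..(2 * r⁻¹), 1 - charFun ν t‖ ≤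
      (2 * r⁻¹) ^ α * |2 * r⁻¹ - -2 * r⁻¹| := by
    refine intervalIntegral.norm_integral_le_of_norm_le_const fun t ht => (h t).trans ?_
    have hr' : 0 < r⁻¹ := inv_pos.mpr hr
    rw [Set.uIoc_of_le (by linarith)] at ht
    exact Real.rpow_le_rpow (abs_nonneg _) (abs_le.mpr ⟨by linarith [ht.1], ht.2⟩) hα
  calc _ ≤ 2⁻¹ * r * ((2 * r⁻¹) ^ α * |2 * r⁻¹ - -2 * r⁻¹|) := by gcongr
    _ = _ := by
      rw [show 2 * r⁻¹ - -2 * r⁻¹ = 4 * r⁻¹ by ring, abs_of_pos (by positivity),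
        Real.mul_rpow (by norm_num) (by positivity), Real.inv_rpow hr.le, Real.rpow_neg hr.le]
      field_simp
      norm_num

/-- Layer-cake formula, with the trivial tail bound for `t ≤ 1` and the `t^{-α}` bound beyond. -/
theorem integrable_abs_rpow_of_norm_one_sub_charFun_le {ν : Measure ℝ} [IsProbabilityMeasure ν]
    {α p : ℝ} (hp : 0 < p) (hpα : p < α) (h : ∀ t : ℝ, ‖1 - charFun ν t‖ ≤ |t| ^ α) :
    Integrable (fun y : ℝ => |y| ^ p) ν := by
  have hα : 0 < α := hp.trans hpα
  refine ⟨(Measurable.pow_const (by fun_prop) p).aestronglyMeasurable, ?_⟩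
  have h2 : (1 : ℝ) ≤ 2 * 2 ^ α := by
    have := Real.one_le_rpow (x := 2) (by norm_num) hα.le
    linarith
  have hint := (integrableOn_ite_rpow (a := p - 1) (b := p - 1 - α) (by linarith)
    (by linarith)).const_mul (2 * 2 ^ α)
  rw [hasFiniteIntegral_iff_ofReal (Eventually.of_forall fun y => by positivity),
    lintegral_rpow_eq_lintegral_meas_lt_mul ν (Eventually.of_forall fun y => abs_nonneg y)
    (by fun_prop) hp]
  refine ENNReal.mul_lt_top ENNReal.ofReal_lt_top (lt_of_le_of_lt ?_ hint.lintegral_lt_top)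
  refine setLIntegral_mono_ae' measurableSet_Ioi (Eventually.of_forall fun t (ht : 0 < t) => ?_)
  rw [← ofReal_measureReal, ← ENNReal.ofReal_mul measureReal_nonneg]
  refine ENNReal.ofReal_le_ofReal ?_
  split_ifs with h1
  · gcongr
    exact measureReal_le_one.trans h2
  · calc _ ≤ (2 * 2 ^ α * t ^ (-α)) * t ^ (p - 1) := by
          gcongr
          exact measureReal_abs_gt_le_of_norm_one_sub_charFun_le hα.le h ht
      _ = _ := by rw [mul_assoc, ← Real.rpow_add ht, show -α + (p - 1) = p - 1 - α by ring]

theorem integrable_id_of_norm_one_sub_charFun_le {ν : Measure ℝ} [IsProbabilityMeasure ν]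
    {α : ℝ} (hα : 1 < α) (h : ∀ t : ℝ, ‖1 - charFun ν t‖ ≤ |t| ^ α) :
    Integrable (fun y : ℝ => y) ν := by
  have := integrable_abs_rpow_of_norm_one_sub_charFun_le one_pos hα h
  simp only [Real.rpow_one] at this
  exact (integrable_norm_iff (by fun_prop)).mp this

/-- Since `α > 1`, the bound forces the derivative of the characteristic function at `0` to vanish,
and that derivative is `i` times the mean. -/
theorem integral_id_eq_zero_of_norm_one_sub_charFun_le {ν : Measure ℝ} [IsProbabilityMeasure ν]
    {α : ℝ} (hα : 1 < α) (h : ∀ t : ℝ, ‖1 - charFun ν t‖ ≤ |t| ^ α) :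
    ∫ y, y ∂ν = 0 := by
  have hd : HasDerivAt (charFun ν) 0 0 := by
    rw [hasDerivAt_iff_tendsto]
    have hlim : Tendsto (fun t : ℝ => |t| ^ (α - 1)) (𝓝 0) (𝓝 0) := by
      have hc : Continuous fun t : ℝ => |t| ^ (α - 1) :=
        continuous_abs.rpow_const fun _ => Or.inr (by linarith)
      have := hc.tendsto 0
      rwa [abs_zero, Real.zero_rpow (by linarith)] at this
    refine squeeze_zero (fun t => by positivity) (fun t => ?_) hlim
    rcases eq_or_ne t 0 with rfl | ht
    · simp [Real.zero_rpow (show α - 1 ≠ 0 by linarith)]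
    · have ht' : 0 < |t| := abs_pos.mpr ht
      rw [sub_zero, smul_zero, sub_zero, charFun_zero, probReal_univ, Complex.ofReal_one,
        norm_sub_rev, Real.norm_eq_abs, Real.rpow_sub_one ht'.ne', inv_mul_eq_div]
      gcongr
      exact h t
  have hmem : MemLp id ((1 : ℕ) : ENNReal) ν := by
    rw [Nat.cast_one, memLp_one_iff_integrable]
    exact integrable_id_of_norm_one_sub_charFun_le hα h
  have h1 := iteratedDeriv_charFun_zero hmem
  rw [iteratedDeriv_one, hd.deriv] at h1
  simpa [integral_complex_ofReal] using h1.symm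

/-- Move the point to `0`. The average of the characteristic function over `[-r, r]` equals
`E[sinc(rY)]`, which tends to the mass at `0`; integrability makes the same average `O(1/r)`. -/
theorem nullSingletonClass_of_integrable_charFun {ν : Measure ℝ} [IsProbabilityMeasure ν]
    (h : Integrable (charFun ν)) : NullSingletonClass ν := by
  refine ⟨fun x => ?_⟩
  set ν' : Measure ℝ := ν.map (· + -x) with hν'
  have hprob : IsProbabilityMeasure ν' := Measure.isProbabilityMeasure_map (by fun_prop)
  have hx : ν' {0} = ν {x} := by
    rw [hν', Measure.map_apply (by fun_prop) (measurableSet_singleton 0)]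
    congr 1
    ext y
    simp
  have hnorm : ∀ t, ‖charFun ν' t‖ = ‖charFun ν t‖ := fun t => by
    rw [hν', charFun_map_add_const, norm_mul, Complex.norm_exp_ofReal_mul_I, mul_one]
  have h1 : Tendsto (fun r : ℝ => ∫ y, Real.sinc (r * y) ∂ν') atTop
      (𝓝 (∫ y, ({0} : Set ℝ).indicator (fun _ => (1 : ℝ)) y ∂ν')) := by
    refine tendsto_integral_filter_of_dominated_convergence (fun _ => 1)
      (Eventually.of_forall fun r =>
        (Real.continuous_sinc.comp (by fun_prop)).aestronglyMeasurable)
      (Eventually.of_forall fun r => Eventually.of_forall fun y => Real.abs_sinc_le_one _)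
      (integrable_const _) (Eventually.of_forall fun y => ?_)
    rcases eq_or_ne y 0 with rfl | hy
    · simp
    · rw [Set.indicator_of_notMem (by simpa using hy)]
      have hlim : Tendsto (fun r : ℝ => |r * y|⁻¹) atTop (𝓝 0) := by
        simp only [abs_mul]
        exact (tendsto_abs_atTop_atTop.atTop_mul_const (abs_pos.mpr hy)).inv_tendsto_atTop
      refine squeeze_zero_norm' ?_ hlim
      filter_upwards [eventually_gt_atTop 0] with r hr
      have hry : r * y ≠ 0 := mul_ne_zero hr.ne' hy
      rw [Real.sinc_of_ne_zero hry, norm_div, Real.norm_eq_abs, Real.norm_eq_abs, div_eq_mul_inv]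
      exact mul_le_of_le_one_left (by positivity) (Real.abs_sin_le_one _)
  have h2 : Tendsto (fun r : ℝ => ∫ y, Real.sinc (r * y) ∂ν') atTop (𝓝 0) := by
    have hlim : Tendsto (fun r : ℝ => (∫ t, ‖charFun ν t‖) * (2 * r)⁻¹) atTop (𝓝 0) := by
      simpa using ((tendsto_id.const_mul_atTop (two_pos (α := ℝ))).inv_tendsto_atTop).const_mul
        (∫ t, ‖charFun ν t‖)
    refine squeeze_zero_norm' ?_ hlim
    filter_upwards [eventually_gt_atTop 0] with r hr
    have h3 := integral_charFun_Icc (μ := ν') hr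
    have h4 : ‖∫ t in -r..r, charFun ν' t‖ ≤ ∫ t, ‖charFun ν t‖ := by
      rw [intervalIntegral.integral_of_le (by linarith)]
      refine (norm_integral_le_integral_norm _).trans ?_
      simp only [hnorm]
      exact setIntegral_le_integral h.norm (Eventually.of_forall fun t => norm_nonneg _)
    rw [h3, norm_mul, norm_mul, Complex.norm_real, Complex.norm_real, Complex.norm_ofNat,
      Real.norm_of_nonneg hr.le, mul_comm] at h4
    rwa [← div_eq_mul_inv, le_div_iff₀ (by positivity)]
  have h5 := tendsto_nhds_unique h1 h2
  rw [integral_indicator_const _ (measurableSet_singleton 0), smul_eq_mul, mul_one,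
    measureReal_eq_zero_iff] at h5
  rw [← hx, h5]

/-! ### Characteristic functions of stable type -/

section StableExponent

variable {ν : Measure ℝ} [IsProbabilityMeasure ν] {α φ : ℝ}

theorem norm_exp_neg_mul_I (φ : ℝ) : ‖Complex.exp (-(φ * Complex.I))‖ = 1 := by
  rw [← neg_mul, ← Complex.ofReal_neg, Complex.norm_exp_ofReal_mul_I]

theorem re_exp_neg_mul_I (φ : ℝ) : (Complex.exp (-(φ * Complex.I))).re = Real.cos φ := by
  rw [← neg_mul, ← Complex.ofReal_neg, Complex.exp_ofReal_mul_I_re, Real.cos_neg]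

theorem cos_pos_of_abs_lt (hφ : |φ| < Real.pi / 2) : 0 < Real.cos φ :=
  Real.cos_pos_of_mem_Ioo ⟨by linarith [neg_abs_le φ], by linarith [le_abs_self φ]⟩

theorem norm_one_sub_charFun_le_rpow (hφ : |φ| < Real.pi / 2)
    (hν : ∀ t : ℝ, 0 < t → charFun ν t =
      Complex.exp (-(Complex.exp (-(φ * Complex.I)) * ((t ^ α : ℝ) : ℂ)))) (t : ℝ) :
    ‖1 - charFun ν t‖ ≤ |t| ^ α := by
  have hpos : ∀ t : ℝ, 0 < t → ‖1 - charFun ν t‖ ≤ t ^ α := fun t ht => by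
    have hta : 0 < t ^ α := Real.rpow_pos_of_pos ht α
    rw [norm_sub_rev, hν t ht]
    refine (norm_exp_sub_one_le_norm (re_neg_mul_ofReal_nonpos ?_ hta.le)).trans (le_of_eq ?_)
    · rw [re_exp_neg_mul_I]
      exact (cos_pos_of_abs_lt hφ).le
    · rw [norm_neg, norm_mul, norm_exp_neg_mul_I, one_mul, Complex.norm_real,
        Real.norm_of_nonneg hta.le]
  rcases lt_trichotomy t 0 with ht | rfl | ht
  · have h := hpos (-t) (by linarith)
    rw [charFun_neg] at h
    rw [abs_of_neg ht]
    calc _ = ‖(starRingEnd ℂ) (1 - charFun ν t)‖ := (RCLike.norm_conj _).symm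
      _ ≤ _ := by simpa using h
  · simp only [charFun_zero, probReal_univ, Complex.ofReal_one, sub_self, norm_zero]
    positivity
  · rw [abs_of_pos ht]
    exact hpos t ht

theorem norm_charFun_eq_of_pos {ν : Measure ℝ} (hν : ∀ t : ℝ, 0 < t → charFun ν t =
      Complex.exp (-(Complex.exp (-(φ * Complex.I)) * ((t ^ α : ℝ) : ℂ)))) {t : ℝ} (ht : 0 < t) :
    ‖charFun ν t‖ = Real.exp (-Real.cos φ * t ^ α) := by
  rw [hν t ht, Complex.norm_exp, Complex.neg_re, Complex.re_mul_ofReal, re_exp_neg_mul_I, neg_mul]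

theorem integrable_charFun_of_stable (hα : 0 < α) (hφ : |φ| < Real.pi / 2)
    (hν : ∀ t : ℝ, 0 < t → charFun ν t =
      Complex.exp (-(Complex.exp (-(φ * Complex.I)) * ((t ^ α : ℝ) : ℂ)))) :
    Integrable (charFun ν) := by
  have hI : IntegrableOn (charFun ν) (Set.Ioi 0) := by
    refine Integrable.mono' (integrableOn_rpow_mul_exp_neg_mul_rpow (s := 0) (by norm_num) hα
      (cos_pos_of_abs_lt hφ)) measurable_charFun.aestronglyMeasurable
      ((ae_restrict_iff' measurableSet_Ioi).mpr (Eventually.of_forall fun t (ht : 0 < t) => ?_))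
    rw [norm_charFun_eq_of_pos hν ht, Real.rpow_zero, one_mul]
  have hneg : IntegrableOn (charFun ν) (Set.Iio 0) := by
    refine (integrable_norm_iff measurable_charFun.aestronglyMeasurable).mp ?_
    have h := IntegrableOn.comp_neg_Iio (c := (0 : ℝ)) (f := fun t => ‖charFun ν t‖)
      (by rw [neg_zero]; exact hI.norm)
    refine (h.congr_fun (fun t _ => ?_) measurableSet_Iio)
    simp [charFun_neg]
  rw [← integrableOn_univ, ← Set.Iio_union_Ici (a := (0 : ℝ)), integrableOn_union,
    integrableOn_Ici_iff_integrableOn_Ioi]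
  exact ⟨hneg, hI⟩

end StableExponent

/-! ### Complex moments of the positive part -/

/-- Interpolates between the linear and quadratic bounds: the second moment need not exist, but
moments of order `p < α` do. -/
theorem norm_exp_sub_one_sub_le_rpow {z : ℂ} {p : ℝ} (hz : z.re ≤ 0) (hp1 : 1 ≤ p) (hp2 : p ≤ 2) :
    ‖Complex.exp z - 1 - z‖ ≤ 2 * ‖z‖ ^ p := by
  rcases eq_or_ne z 0 with rfl | h0
  · simp [Real.zero_rpow (show p ≠ 0 by linarith)]
  have hpos : 0 < ‖z‖ := norm_pos_iff.mpr h0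
  rcases le_total ‖z‖ 1 with h | h
  · refine (norm_exp_sub_one_sub_le_sq hz).trans ?_
    gcongr
    rw [← Real.rpow_natCast]
    exact Real.rpow_le_rpow_of_exponent_ge hpos h (by exact_mod_cast hp2)
  · refine (norm_exp_sub_one_sub_le_norm hz).trans ?_
    gcongr
    exact Real.self_le_rpow_of_one_le h hp1

theorem integral_exp_sub_one_sub_mul_cpow' {l w : ℂ} (hl : 0 ≤ l.re)
    (hw1 : 1 < w.re) (hw2 : w.re < 2) :
    ∫ t : ℝ in Set.Ioi 0, (Complex.exp (-(l * t)) - 1 + l * t) * (t : ℂ) ^ (-w - 1) =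
      Complex.Gamma (-w) * l ^ w := by
  rcases eq_or_ne l 0 with rfl | hl0
  · have hw : w ≠ 0 := fun h => by norm_num [h] at hw1
    simp [Complex.zero_cpow hw]
  · exact integral_exp_sub_one_sub_mul_cpow hl hl0 hw1 hw2

theorem ofReal_mul_I_cpow {r : ℝ} (hr : 0 < r) (w : ℂ) :
    ((r : ℂ) * Complex.I) ^ w = (r : ℂ) ^ w * Complex.exp (Real.pi * w / 2 * Complex.I) := by
  have hr0 : (r : ℂ) ≠ 0 := Complex.ofReal_ne_zero.mpr hr.ne'
  rw [Complex.cpow_def_of_ne_zero (mul_ne_zero hr0 Complex.I_ne_zero),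
    Complex.log_ofReal_mul hr Complex.I_ne_zero, Complex.log_I, Complex.cpow_def_of_ne_zero hr0,
    ← Complex.exp_add, Complex.ofReal_log hr.le]
  congr 1
  ring

theorem neg_ofReal_mul_I_cpow {r : ℝ} (hr : 0 < r) (w : ℂ) :
    (-((r : ℂ) * Complex.I)) ^ w =
      (r : ℂ) ^ w * Complex.exp (-(Real.pi * w / 2 * Complex.I)) := by
  have hr0 : (r : ℂ) ≠ 0 := Complex.ofReal_ne_zero.mpr hr.ne'
  have hI : -Complex.I ≠ 0 := neg_ne_zero.mpr Complex.I_ne_zero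
  rw [← mul_neg, Complex.cpow_def_of_ne_zero (mul_ne_zero hr0 hI),
    Complex.log_ofReal_mul hr hI, Complex.log_neg_I, Complex.cpow_def_of_ne_zero hr0,
    ← Complex.exp_add, Complex.ofReal_log hr.le]
  congr 1
  ring

/-- For `y < 0` each phase undoes the argument of its power and the two terms cancel; for `y > 0`
the phases double to `e^{±iπw}`. -/
theorem exp_mul_cpow_sub_exp_mul_cpow (y : ℝ) {w : ℂ} (hw : w ≠ 0) :
    Complex.exp (Real.pi * w / 2 * Complex.I) * ((y : ℂ) * Complex.I) ^ w -
      Complex.exp (-(Real.pi * w / 2 * Complex.I)) * (-((y : ℂ) * Complex.I)) ^ w =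
    2 * Complex.I * Complex.sin (Real.pi * w) * if 0 < y then (y : ℂ) ^ w else 0 := by
  have hsin : 2 * Complex.I * Complex.sin (Real.pi * w) =
      Complex.exp (Real.pi * w / 2 * Complex.I) * Complex.exp (Real.pi * w / 2 * Complex.I) -
      Complex.exp (-(Real.pi * w / 2 * Complex.I)) *
        Complex.exp (-(Real.pi * w / 2 * Complex.I)) := by
    rw [← Complex.exp_add, ← Complex.exp_add, Complex.sin]
    ring_nf
    rw [Complex.I_sq]
    ring
  rcases lt_trichotomy y 0 with hy | rfl | hy
  · have e1 : (y : ℂ) * Complex.I = -(((-y : ℝ) : ℂ) * Complex.I) := by push_cast; ring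
    rw [if_neg hy.not_gt, e1, neg_neg, ofReal_mul_I_cpow (by linarith),
      neg_ofReal_mul_I_cpow (by linarith)]
    ring
  · simp [Complex.zero_cpow hw]
  · rw [if_pos hy, ofReal_mul_I_cpow hy, neg_ofReal_mul_I_cpow hy, hsin]
    ring

theorem exp_ofReal_mul_I_cpow {φ : ℝ} (hφ : |φ| < Real.pi / 2) (v : ℂ) :
    Complex.exp (φ * Complex.I) ^ v = Complex.exp (φ * Complex.I * v) := by
  rw [Complex.cpow_def_of_ne_zero (Complex.exp_ne_zero _), Complex.log_exp] <;> simp <;>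
    linarith [Real.pi_pos, neg_abs_le φ, le_abs_self φ]

theorem integral_exp_neg_mul_rpow_sub_one_mul_cpow {α : ℝ} {l w : ℂ} (hα : 0 < α) (hl : 0 ≤ l.re)
    (hl0 : l ≠ 0) (hw0 : 0 < w.re) (hwα : w.re < α) :
    ∫ t : ℝ in Set.Ioi 0, (Complex.exp (-(l * ((t ^ α : ℝ) : ℂ))) - 1) * (t : ℂ) ^ (-w - 1) =
      1 / α * (Complex.Gamma (-(w / α)) * l ^ (w / α)) := by
  have hα' : (α : ℂ) ≠ 0 := Complex.ofReal_ne_zero.mpr hα.ne'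
  rw [← integral_exp_sub_one_mul_cpow hl hl0 (v := w / α)
    (by rw [Complex.div_ofReal_re]; positivity)
    (by rw [Complex.div_ofReal_re, div_lt_one hα]; exact hwα),
    ← integral_comp_rpow_Ioi_of_pos
      (g := fun u : ℝ => (Complex.exp (-(l * u)) - 1) * (u : ℂ) ^ (-(w / α) - 1)) hα,
    ← integral_const_mul]
  refine setIntegral_congr_fun measurableSet_Ioi fun t (ht : 0 < t) => ?_
  have ht0 : (t : ℂ) ≠ 0 := Complex.ofReal_ne_zero.mpr ht.ne'
  have e : ((t ^ α : ℝ) : ℂ) ^ (-(w / α) - 1) * ((t ^ (α - 1) : ℝ) : ℂ) = (t : ℂ) ^ (-w - 1) := by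
    have htα : (0 : ℝ) < t ^ α := Real.rpow_pos_of_pos ht α
    rw [Complex.ofReal_cpow ht.le (α - 1),
      Complex.cpow_def_of_ne_zero (Complex.ofReal_ne_zero.mpr htα.ne'), ← Complex.ofReal_log htα.le,
      Real.log_rpow ht, Complex.cpow_def_of_ne_zero ht0, Complex.cpow_def_of_ne_zero ht0,
      ← Complex.ofReal_log ht.le, ← Complex.exp_add]
    congr 1
    push_cast
    field_simp
    ring
  simp only [Complex.real_smul, Complex.ofReal_mul]
  rw [← e]
  field_simp

/-- Justifies Fubini: the integrand is `O(|y|^p t^{p - Re w - 1})` for `t ≤ 1` and `O(|y| t^{-Re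
w})` for `t > 1`. -/
theorem integrable_exp_sub_one_sub_mul_cpow_prod {ν : Measure ℝ} {p ε : ℝ} {w : ℂ} (hε : |ε| = 1) (hw1 : 1 < w.re)
    (hwp : w.re < p) (hp2 : p ≤ 2) (hp : Integrable (fun y : ℝ => |y| ^ p) ν)
    (h1 : Integrable (fun y : ℝ => y) ν) :
    Integrable (fun x : ℝ × ℝ => (Complex.exp (-(-(((ε * x.2 : ℝ) : ℂ) * Complex.I) * x.1)) - 1 +
      -(((ε * x.2 : ℝ) : ℂ) * Complex.I) * x.1) * (x.1 : ℂ) ^ (-w - 1))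
      ((volume.restrict (Set.Ioi 0)).prod ν) := by
  have hb := Integrable.mul_prod (integrableOn_ite_rpow (a := p - w.re - 1) (b := -w.re)
    (by linarith) (by linarith)) ((hp.add h1.abs).const_mul 2)
  refine Integrable.mono' hb (Measurable.aestronglyMeasurable (by fun_prop)) ?_
  filter_upwards [Measure.quasiMeasurePreserving_fst.ae (ae_restrict_mem measurableSet_Ioi)]
    with x (hx : 0 < x.1)
  obtain ⟨t, y⟩ := x
  simp only at hx ⊢
  have hl : 0 ≤ (-(((ε * y : ℝ) : ℂ) * Complex.I)).re := by simp
  have hre := re_neg_mul_ofReal_nonpos hl hx.le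
  have hn : ‖-(-(((ε * y : ℝ) : ℂ) * Complex.I) * t)‖ = |y| * t := by
    rw [norm_neg, norm_mul, norm_neg, norm_mul, Complex.norm_I, Complex.norm_real,
      Complex.norm_real, Real.norm_eq_abs, Real.norm_of_nonneg hx.le, abs_mul, hε]
    ring
  rw [norm_mul, Complex.norm_cpow_eq_rpow_re_of_pos hx, Complex.sub_re, Complex.neg_re,
    Complex.one_re, ← sub_neg_eq_add (Complex.exp _ - 1)]
  simp only [Pi.add_apply]
  have hy : 0 ≤ |y| := abs_nonneg y
  have hyp : 0 ≤ |y| ^ p := Real.rpow_nonneg hy p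
  split_ifs with h
  · calc _ ≤ (2 * (|y| * t) ^ p) * t ^ (-w.re - 1) := by
          gcongr
          refine (norm_exp_sub_one_sub_le_rpow hre (by linarith) hp2).trans ?_
          rw [hn]
      _ = t ^ (p - w.re - 1) * (2 * |y| ^ p) := by
          rw [Real.mul_rpow hy hx.le, show p - w.re - 1 = p + (-w.re - 1) by ring,
            Real.rpow_add hx]
          ring
      _ ≤ _ := by
          gcongr
          linarith
  · calc _ ≤ (2 * (|y| * t)) * t ^ (-w.re - 1) := by
          gcongr
          refine (norm_exp_sub_one_sub_le_norm hre).trans ?_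
          rw [hn]
      _ = t ^ (-w.re) * (2 * |y|) := by
          rw [Real.rpow_sub_one hx.ne']
          field_simp
      _ ≤ _ := by
          gcongr
          linarith

section

variable {ν : Measure ℝ} [IsProbabilityMeasure ν]

theorem integral_cpow_eq_integral_charFun {p ε : ℝ} {w : ℂ} (hε : |ε| = 1) (hw1 : 1 < w.re)
    (hwp : w.re < p) (hp2 : p ≤ 2) (hp : Integrable (fun y : ℝ => |y| ^ p) ν)
    (h1 : Integrable (fun y : ℝ => y) ν) (h0 : ∫ y, y ∂ν = 0) :
    Integrable (fun y : ℝ => Complex.Gamma (-w) * (-(((ε * y : ℝ) : ℂ) * Complex.I)) ^ w) ν ∧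
    ∫ y : ℝ, Complex.Gamma (-w) * (-(((ε * y : ℝ) : ℂ) * Complex.I)) ^ w ∂ν =
      ∫ t : ℝ in Set.Ioi 0, (charFun ν (ε * t) - 1) * (t : ℂ) ^ (-w - 1) := by
  have hI := integrable_exp_sub_one_sub_mul_cpow_prod hε hw1 hwp hp2 hp h1
  have hin : ∀ y : ℝ, ∫ t : ℝ in Set.Ioi 0,
      (Complex.exp (-(-(((ε * y : ℝ) : ℂ) * Complex.I) * t)) - 1 +
        -(((ε * y : ℝ) : ℂ) * Complex.I) * t) * (t : ℂ) ^ (-w - 1) =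
      Complex.Gamma (-w) * (-(((ε * y : ℝ) : ℂ) * Complex.I)) ^ w := fun y =>
    integral_exp_sub_one_sub_mul_cpow' (by simp) hw1 (by linarith)
  simp only [← hin]
  refine ⟨hI.integral_prod_right, ?_⟩
  rw [← integral_integral_swap hI]
  refine setIntegral_congr_fun measurableSet_Ioi fun t _ => ?_
  rw [integral_mul_const]
  congr 1
  have e1 : ∀ y : ℝ, Complex.exp (-(-(((ε * y : ℝ) : ℂ) * Complex.I) * t)) =
      Complex.exp (((ε * t : ℝ) : ℂ) * y * Complex.I) := fun y => by
    congr 1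
    push_cast
    ring
  have hE : Integrable (fun y : ℝ => Complex.exp (((ε * t : ℝ) : ℂ) * y * Complex.I)) ν := by
    refine Integrable.of_bound (by fun_prop) 1 (Eventually.of_forall fun y => ?_)
    rw [← Complex.ofReal_mul, Complex.norm_exp_ofReal_mul_I]
  have hL : Integrable (fun y : ℝ => -(((ε * y : ℝ) : ℂ) * Complex.I) * t) ν := by
    have := (h1.ofReal (𝕜 := ℂ)).const_mul (-(ε * Complex.I * t))
    refine this.congr (Eventually.of_forall fun y => ?_)
    change -(ε * Complex.I * t) * (y : ℂ) = _
    push_cast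
    ring
  -- The second compensator disappears because the mean is zero.
  have hL0 : ∫ y : ℝ, -(((ε * y : ℝ) : ℂ) * Complex.I) * t ∂ν = 0 := by
    calc _ = ∫ y : ℝ, (-(ε * Complex.I * t)) * (y : ℂ) ∂ν := by
          congr 1 with y
          push_cast
          ring
      _ = 0 := by
          rw [integral_const_mul, integral_complex_ofReal, h0]
          simp
  simp only [e1]
  have hE1 : Integrable
      (fun y : ℝ => Complex.exp (((ε * t : ℝ) : ℂ) * y * Complex.I) - 1) ν :=
    hE.sub (integrable_const _)
  rw [integral_add hE1 hL, hL0, integral_sub hE (integrable_const _), ← charFun_apply_real]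
  simp

theorem integral_pos_part_cpow {α φ : ℝ} {w : ℂ} (hα2 : α ≤ 2) (hφ : |φ| < Real.pi / 2)
    (hν : ∀ t : ℝ, 0 < t → charFun ν t =
      Complex.exp (-(Complex.exp (-(φ * Complex.I)) * ((t ^ α : ℝ) : ℂ))))
    (hw1 : 1 < w.re) (hwα : w.re < α) :
    ∫ y : ℝ, (if 0 < y then (y : ℂ) ^ w else 0) ∂ν =
      Complex.Gamma w * Complex.Gamma (1 - w / α) *
        Complex.sin (Real.pi * ((1 / 2 + φ / (α * Real.pi) : ℝ) : ℂ) * w) / Real.pi := by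
  have hα : 0 < α := by linarith
  have hb := norm_one_sub_charFun_le_rpow hφ hν
  have h1 := integrable_id_of_norm_one_sub_charFun_le (by linarith) hb
  have h0 := integral_id_eq_zero_of_norm_one_sub_charFun_le (by linarith) hb
  obtain ⟨p, hwp, hpα⟩ := exists_between hwα
  have hp := integrable_abs_rpow_of_norm_one_sub_charFun_le (by linarith) hpα hb
  obtain ⟨hI1, hE1⟩ := integral_cpow_eq_integral_charFun (ε := 1) (w := w) (by simp) hw1 hwp
    (by linarith) hp h1 h0
  obtain ⟨hI2, hE2⟩ := integral_cpow_eq_integral_charFun (ε := -1) (w := w) (by simp) hw1 hwp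
    (by linarith) hp h1 h0
  have hw : w ≠ 0 := fun h => by norm_num [h] at hw1
  have hcos := cos_pos_of_abs_lt hφ
  have hR1 : ∫ t : ℝ in Set.Ioi 0, (charFun ν (1 * t) - 1) * (t : ℂ) ^ (-w - 1) =
      1 / α * (Complex.Gamma (-(w / α)) * Complex.exp (-(φ * Complex.I * (w / α)))) := by
    have e := exp_ofReal_mul_I_cpow (φ := -φ) (by rwa [abs_neg]) (w / α)
    rw [Complex.ofReal_neg, neg_mul, neg_mul] at e
    rw [← e, ← integral_exp_neg_mul_rpow_sub_one_mul_cpow hα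
      (by rw [re_exp_neg_mul_I]; exact hcos.le) (Complex.exp_ne_zero _) (by linarith) hwα]
    refine setIntegral_congr_fun measurableSet_Ioi fun t ht => ?_
    simp only [one_mul]
    rw [hν t ht]
  have hR2 : ∫ t : ℝ in Set.Ioi 0, (charFun ν (-1 * t) - 1) * (t : ℂ) ^ (-w - 1) =
      1 / α * (Complex.Gamma (-(w / α)) * Complex.exp (φ * Complex.I * (w / α))) := by
    rw [← exp_ofReal_mul_I_cpow hφ, ← integral_exp_neg_mul_rpow_sub_one_mul_cpow hα
      (by rw [Complex.exp_ofReal_mul_I_re]; exact hcos.le) (Complex.exp_ne_zero _) (by linarith)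
      hwα]
    refine setIntegral_congr_fun measurableSet_Ioi fun t ht => ?_
    simp only [neg_one_mul]
    rw [charFun_neg, hν t ht, ← Complex.exp_conj]
    simp [← Complex.exp_conj]
  -- The combination that isolates `y > 0`: `e^{iπw/2}` times the `ε = -1` identity minus
  -- `e^{-iπw/2}` times the `ε = 1` identity.
  have key : Complex.Gamma (-w) * (2 * Complex.I * Complex.sin (Real.pi * w)) *
      ∫ y : ℝ, (if 0 < y then (y : ℂ) ^ w else 0) ∂ν =
      Complex.exp (Real.pi * w / 2 * Complex.I) *
        (1 / α * (Complex.Gamma (-(w / α)) * Complex.exp (φ * Complex.I * (w / α)))) -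
      Complex.exp (-(Real.pi * w / 2 * Complex.I)) *
        (1 / α * (Complex.Gamma (-(w / α)) * Complex.exp (-(φ * Complex.I * (w / α))))) := by
    rw [← hR1, ← hR2, ← hE1, ← hE2, ← integral_const_mul, ← integral_const_mul,
      ← integral_const_mul, ← integral_sub (hI2.const_mul _) (hI1.const_mul _)]
    refine integral_congr_ae (Eventually.of_forall fun y => ?_)
    simp only
    rw [mul_assoc, ← exp_mul_cpow_sub_exp_mul_cpow y hw]
    push_cast
    simp only [neg_mul, neg_neg, one_mul]
    ring
  have hα' : (α : ℂ) ≠ 0 := Complex.ofReal_ne_zero.mpr hα.ne'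
  have hπ : (Real.pi : ℂ) ≠ 0 := Complex.ofReal_ne_zero.mpr Real.pi_pos.ne'
  have hsin : Complex.exp (Real.pi * w / 2 * Complex.I) * Complex.exp (φ * Complex.I * (w / α)) -
      Complex.exp (-(Real.pi * w / 2 * Complex.I)) * Complex.exp (-(φ * Complex.I * (w / α))) =
      2 * Complex.I * Complex.sin (Real.pi * ((1 / 2 + φ / (α * Real.pi) : ℝ) : ℂ) * w) := by
    rw [← Complex.exp_add, ← Complex.exp_add, ← neg_add,
      show Real.pi * w / 2 * Complex.I + φ * Complex.I * (w / α) =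
        (Real.pi * ((1 / 2 + φ / (α * Real.pi) : ℝ) : ℂ) * w) * Complex.I by
          push_cast; field_simp, ← neg_mul, Complex.sin]
    ring_nf
    rw [Complex.I_sq]
    ring
  -- Here `1 < Re w < 2`, so `w` is not an integer.
  have hsw : Complex.sin (Real.pi * w) ≠ 0 := by
    rw [Complex.sin_ne_zero_iff]
    intro k hk
    have : w = k := mul_left_cancel₀ hπ (by rw [hk, mul_comm])
    rw [this, Complex.intCast_re] at hw1 hwα
    have h3 : (1 : ℤ) < k := by exact_mod_cast hw1
    have h4 : (k : ℝ) < ((2 : ℤ) : ℝ) := by push_cast; linarith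
    have h5 : k < 2 := by exact_mod_cast h4
    omega
  have hΓ : Complex.Gamma (-w) * (w * Complex.Gamma w) * Complex.sin (Real.pi * w) = -Real.pi := by
    have h := Complex.Gamma_mul_Gamma_one_sub (-w)
    rw [sub_neg_eq_add, add_comm 1 w, Complex.Gamma_add_one w hw, mul_neg, Complex.sin_neg] at h
    rw [h]
    field_simp
  have hΓ2 : Complex.Gamma (1 - w / α) = -(w / α) * Complex.Gamma (-(w / α)) := by
    rw [← Complex.Gamma_add_one _ (neg_ne_zero.mpr (div_ne_zero hw hα'))]
    congr 1
    ring
  rw [hΓ2]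
  set J := ∫ y : ℝ, (if 0 < y then (y : ℂ) ^ w else 0) ∂ν
  set sγ := Complex.sin (Real.pi * ((1 / 2 + φ / (α * Real.pi) : ℝ) : ℂ) * w)
  have key2 : Complex.Gamma (-w) * Complex.sin (Real.pi * w) * J =
      1 / α * Complex.Gamma (-(w / α)) * sγ := by
    have h2I : 2 * Complex.I ≠ 0 := by simp
    refine mul_left_cancel₀ h2I ?_
    linear_combination key + 1 / α * Complex.Gamma (-(w / α)) * hsin
  rw [eq_div_iff hπ]
  linear_combination J * hΓ - w * Complex.Gamma w * key2

end

/-! ### The Mellin transform of the tail mean -/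

theorem continuous_integral_Ioi {ν : Measure ℝ} [NullSingletonClass ν] {f : ℝ → ℝ}
    (hf : Integrable f ν) : Continuous fun x : ℝ => ∫ y in Set.Ioi x, f y ∂ν := by
  have h : (fun x : ℝ => ∫ y in Set.Ioi x, f y ∂ν) =
      fun x => ∫ y in Set.Ioi 0, f y ∂ν - ∫ y in (0 : ℝ)..x, f y ∂ν := by
    ext x
    rw [← intervalIntegral.integral_Ioi_sub_Ioi' hf.integrableOn hf.integrableOn]
    ring
  rw [h]
  exact continuous_const.sub
    (intervalIntegral.continuous_primitive (fun a b => hf.intervalIntegrable) 0)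

/-- For large `t` the factor `y` alone does not give decay in `t`; on `t < y` it is at most `t^{1-p}
y^p`. -/
theorem integrable_cpow_mul_tail_prod {ν : Measure ℝ} {p : ℝ} {s : ℂ} (hs : 0 < s.re)
    (hsp : s.re + 1 < p) (hp : Integrable (fun y : ℝ => |y| ^ p) ν)
    (h1 : Integrable (fun y : ℝ => y) ν) :
    Integrable (fun x : ℝ × ℝ => (x.1 : ℂ) ^ (s - 1) * if x.1 < x.2 then (x.2 : ℂ) else 0)
      ((volume.restrict (Set.Ioi 0)).prod ν) := by
  have hb := Integrable.mul_prod (integrableOn_ite_rpow (a := s.re - 1) (b := s.re - p)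
    (by linarith) (by linarith)) (hp.add h1.abs)
  have hm : Measurable fun x : ℝ × ℝ =>
      (x.1 : ℂ) ^ (s - 1) * if x.1 < x.2 then (x.2 : ℂ) else 0 :=
    Measurable.mul (by fun_prop)
      (Measurable.ite (measurableSet_lt measurable_fst measurable_snd) (by fun_prop) (by fun_prop))
  refine Integrable.mono' hb hm.aestronglyMeasurable ?_
  filter_upwards [Measure.quasiMeasurePreserving_fst.ae (ae_restrict_mem measurableSet_Ioi)]
    with x (hx : 0 < x.1)
  obtain ⟨t, y⟩ := x
  simp only at hx ⊢
  have hy : 0 ≤ |y| := abs_nonneg y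
  have hyp : 0 ≤ |y| ^ p := Real.rpow_nonneg hy p
  rw [norm_mul, Complex.norm_cpow_eq_rpow_re_of_pos hx, Complex.sub_re, Complex.one_re]
  simp only [Pi.add_apply]
  by_cases hty : t < y
  · rw [if_pos hty, Complex.norm_real, Real.norm_eq_abs]
    split_ifs with h
    · gcongr
      linarith
    · have hy0 : 0 < y := hx.trans hty
      rw [abs_of_pos hy0]
      have h2 : t ^ (p - 1) ≤ y ^ (p - 1) := Real.rpow_le_rpow hx.le hty.le (by linarith)
      calc t ^ (s.re - 1) * y = t ^ (s.re - p) * (t ^ (p - 1) * y) := by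
            rw [← mul_assoc, ← Real.rpow_add hx]
            ring_nf
        _ ≤ t ^ (s.re - p) * (y ^ (p - 1) * y) := by gcongr
        _ = t ^ (s.re - p) * y ^ p := by rw [Real.rpow_sub_one hy0.ne', div_mul_cancel₀ _ hy0.ne']
        _ ≤ _ := by
            gcongr
            linarith
  · rw [if_neg hty, norm_zero, mul_zero]
    split_ifs <;> positivity

theorem integral_cpow_mul_ite_lt {s : ℂ} (hs : 0 < s.re) (y : ℝ) :
    ∫ x : ℝ in Set.Ioi 0, (x : ℂ) ^ (s - 1) * (if x < y then (y : ℂ) else 0) =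
      s⁻¹ * if 0 < y then (y : ℂ) ^ (s + 1) else 0 := by
  have hs0 : s ≠ 0 := fun h => by simp [h] at hs
  have e : (fun x : ℝ => (x : ℂ) ^ (s - 1) * (if x < y then (y : ℂ) else 0)) =
      (Set.Iio y).indicator fun x : ℝ => (x : ℂ) ^ (s - 1) * y := by
    ext x
    by_cases h : x < y <;> simp [h]
  rw [e, setIntegral_indicator measurableSet_Iio, Set.Ioi_inter_Iio, ← integral_Ioc_eq_integral_Ioo,
    integral_mul_const]
  split_ifs with hy
  · rw [← intervalIntegral.integral_of_le hy.le, integral_cpow (Or.inl (by simpa using hs)),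
      sub_add_cancel, Complex.ofReal_zero, Complex.zero_cpow hs0, sub_zero,
      Complex.cpow_add _ _ (Complex.ofReal_ne_zero.mpr hy.ne'), Complex.cpow_one]
    field_simp
  · rw [Set.Ioc_eq_empty hy]
    simp

theorem mellinConvergent_tail_and_mellin_eq {ν : Measure ℝ} [IsProbabilityMeasure ν] {p : ℝ} {s : ℂ}
    (hs : 0 < s.re) (hsp : s.re + 1 < p) (hp : Integrable (fun y : ℝ => |y| ^ p) ν)
    (h1 : Integrable (fun y : ℝ => y) ν) :
    MellinConvergent (fun x : ℝ => ((∫ y in Set.Ioi x, y ∂ν : ℝ) : ℂ)) s ∧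
    mellin (fun x : ℝ => ((∫ y in Set.Ioi x, y ∂ν : ℝ) : ℂ)) s =
      s⁻¹ * ∫ y : ℝ, (if 0 < y then (y : ℂ) ^ (s + 1) else 0) ∂ν := by
  have hI := integrable_cpow_mul_tail_prod hs hsp hp h1
  have e : (fun x : ℝ => (x : ℂ) ^ (s - 1) • ((∫ y in Set.Ioi x, y ∂ν : ℝ) : ℂ)) =
      fun x : ℝ => ∫ y : ℝ, (x : ℂ) ^ (s - 1) * (if x < y then (y : ℂ) else 0) ∂ν := by
    ext x
    rw [integral_const_mul, smul_eq_mul, ← integral_complex_ofReal,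
      ← integral_indicator measurableSet_Ioi]
    rfl
  rw [MellinConvergent, mellin, e]
  refine ⟨hI.integral_prod_left, ?_⟩
  rw [integral_integral_swap hI]
  simp only [integral_cpow_mul_ite_lt hs, integral_const_mul]

/-! ### The Mellin-Barnes kernel -/

/-- The two Gamma factors in the denominator have arguments adding up to `1`, so the reflection
formula turns them into a sine. -/
theorem foxKernel_eq (α γ : ℝ) (s : ℂ) :
    foxKernel 1 1 ![((1 - (α - 1) / α : ℝ) : ℂ), (γ : ℂ)] ![1 / α, γ] ![(0 : ℂ), (γ : ℂ)] ![1, γ] s =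
      Complex.Gamma s * Complex.Gamma (((α - 1) / α : ℝ) - s / α) *
        Complex.sin (Real.pi * γ * (s + 1)) / Real.pi := by
  have h := Complex.Gamma_mul_Gamma_one_sub (γ + γ * s)
  rw [show (1 : ℂ) - (γ + γ * s) = 1 - γ - γ * s by ring, mul_comm,
    show (Real.pi : ℂ) * (γ + γ * s) = Real.pi * γ * (s + 1) by ring] at h
  simp only [foxKernel, Finset.prod_filter, Fin.prod_univ_two, Matrix.cons_val_zero,
    Matrix.cons_val_one, Fin.val_zero, Fin.val_one]
  norm_num
  rw [h, div_div_eq_mul_div]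
  congr 4
  ring

/-- The innermost poles are `s = 0` and `s = α - 1`; the remaining ones impose nothing more. -/
theorem foxSeparates_iff {α γ c : ℝ} (hα : 1 < α) :
    FoxSeparates 1 1 ![((1 - (α - 1) / α : ℝ) : ℂ), (γ : ℂ)] ![1 / α, γ] ![(0 : ℂ), (γ : ℂ)]
      ![1, γ] c ↔ 0 < c ∧ c < α - 1 := by
  have hα0 : 0 < α := by linarith
  have hval : ∀ i : ℕ, (1 - (1 - (α - 1) / α) + (i : ℝ)) / (1 / α) = α - 1 + i * α := fun i => by
    field_simp
    ring
  constructor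
  · rintro ⟨h1, h2⟩
    have h3 := h1 0 (by simp) 0
    have h4 := h2 0 (by simp) 0
    simp only [Matrix.cons_val_zero, Complex.ofReal_re] at h4
    rw [hval] at h4
    simp at h3 h4
    exact ⟨h3, by linarith⟩
  · rintro ⟨h1, h2⟩
    refine ⟨fun j hj i => ?_, fun j hj i => ?_⟩
    · obtain rfl : j = 0 := by ext; simp; omega
      have : (0 : ℝ) ≤ i := Nat.cast_nonneg i
      simp
      linarith
    · obtain rfl : j = 0 := by ext; simp; omega
      simp only [Matrix.cons_val_zero, Complex.ofReal_re]
      rw [hval]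
      have : 0 ≤ (i : ℝ) * α := by positivity
      linarith

theorem integrable_exp_neg_mul_abs {κ : ℝ} (hκ : 0 < κ) :
    Integrable fun y : ℝ => Real.exp (-κ * |y|) := by
  have hI : IntegrableOn (fun y : ℝ => Real.exp (-κ * |y|)) (Set.Ioi 0) := by
    refine (integrableOn_rpow_mul_exp_neg_mul_rpow (s := 0) (by norm_num) one_pos hκ).congr_fun
      (fun t (ht : 0 < t) => ?_) measurableSet_Ioi
    simp [abs_of_pos ht]
  have hneg := IntegrableOn.comp_neg_Iio (c := (0 : ℝ)) (f := fun y : ℝ => Real.exp (-κ * |y|))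
    (by rw [neg_zero]; exact hI)
  simp only [abs_neg] at hneg
  rw [← integrableOn_univ, ← Set.Iio_union_Ici (a := (0 : ℝ)), integrableOn_union,
    integrableOn_Ici_iff_integrableOn_Ioi]
  exact ⟨hneg, hI⟩

theorem norm_sin_le_exp_abs_im (z : ℂ) : ‖Complex.sin z‖ ≤ Real.exp |z.im| := by
  rw [Complex.sin, norm_div, norm_mul, Complex.norm_I, mul_one, Complex.norm_ofNat, neg_mul]
  have h := norm_sub_le (Complex.exp (-z * Complex.I)) (Complex.exp (z * Complex.I))
  rw [Complex.norm_exp, Complex.norm_exp] at h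
  simp at h
  have h1 : Real.exp z.im ≤ Real.exp |z.im| := Real.exp_le_exp.mpr (le_abs_self _)
  have h2 : Real.exp (-z.im) ≤ Real.exp |z.im| := Real.exp_le_exp.mpr (neg_le_abs _)
  rw [div_le_iff₀ two_pos]
  linarith

theorem verticalIntegrable_foxKernel {α γ c : ℝ} (hα : 1 < α) (hγ0 : 0 < γ) (hγ : γ ≤ 1 / α)
    (hc0 : 0 < c) (hc : c < α - 1) :
    Complex.VerticalIntegrable (foxKernel 1 1 ![((1 - (α - 1) / α : ℝ) : ℂ), (γ : ℂ)] ![1 / α, γ]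
      ![(0 : ℂ), (γ : ℂ)] ![1, γ]) c := by
  have hα0 : 0 < α := by linarith
  have hπ := Real.pi_pos
  -- The Gamma factors decay together like `e^{-θ(1 + 1/α)|y|}` for any `θ < π/2`, the sine grows
  -- like `e^{πγ|y|}`. This leaves room for a `θ` with net decay.
  have hlim : Real.pi * γ / (1 + 1 / α) < Real.pi / 2 := by
    rw [div_lt_iff₀ (by positivity)]
    have h1 : 1 / α < 1 := by rw [div_lt_one hα0]; exact hα
    nlinarith
  obtain ⟨θ, hθ1, hθ2⟩ := exists_between hlim
  have hθ0 : 0 ≤ θ := le_trans (by positivity) hθ1.le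
  rw [div_lt_iff₀ (by positivity)] at hθ1
  have hd0 : 0 < (α - 1) / α - c / α := by
    rw [← sub_div]
    exact div_pos (by linarith) hα0
  obtain ⟨C1, hC1⟩ := exists_norm_Gamma_le c θ hc0 hθ0 hθ2
  obtain ⟨C2, hC2⟩ := exists_norm_Gamma_le ((α - 1) / α - c / α) θ hd0 hθ0 hθ2
  have hre1 : ∀ y : ℝ, ((c : ℂ) + y * Complex.I).re = c := fun y => by simp
  have him1 : ∀ y : ℝ, ((c : ℂ) + y * Complex.I).im = y := fun y => by simp
  have hre2 : ∀ y : ℝ, ((((α - 1) / α : ℝ) : ℂ) - ((c : ℂ) + y * Complex.I) / α).re =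
      (α - 1) / α - c / α := fun y => by
    rw [Complex.sub_re, Complex.ofReal_re, Complex.div_ofReal_re, hre1]
  have him2 : ∀ y : ℝ, ((((α - 1) / α : ℝ) : ℂ) - ((c : ℂ) + y * Complex.I) / α).im =
      -(y / α) := fun y => by
    rw [Complex.sub_im, Complex.ofReal_im, Complex.div_ofReal_im, him1, zero_sub]
  have hΓ : ∀ {z : ℂ}, 0 < z.re → ContinuousAt Complex.Gamma z := fun {z} hz =>
    (Complex.differentiableAt_Gamma z fun m h => by
      rw [h, Complex.neg_re, Complex.natCast_re] at hz
      linarith [(Nat.cast_nonneg m : (0 : ℝ) ≤ m)]).continuousAt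
  have hk : 0 < θ * (1 + 1 / α) - Real.pi * γ := by linarith
  refine Integrable.mono' ((integrable_exp_neg_mul_abs hk).const_mul (C1 * C2 / Real.pi))
    (Continuous.aestronglyMeasurable ?_) (Eventually.of_forall fun y => ?_)
  · simp only [foxKernel_eq]
    refine ((Continuous.mul (continuous_iff_continuousAt.mpr fun y => ?_)
      (continuous_iff_continuousAt.mpr fun y => ?_)).mul (by fun_prop)).div_const _
    · exact ContinuousAt.comp (f := fun y : ℝ => (c : ℂ) + y * Complex.I)
        (hΓ (by rw [hre1]; exact hc0)) (by fun_prop)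
    · exact ContinuousAt.comp
        (f := fun y : ℝ => (((α - 1) / α : ℝ) : ℂ) - ((c : ℂ) + y * Complex.I) / α)
        (hΓ (by rw [hre2]; exact hd0)) (by fun_prop)
  · have b1 := hC1 _ (hre1 y)
    have b2 := hC2 _ (hre2 y)
    have b3 := norm_sin_le_exp_abs_im (Real.pi * γ * ((c : ℂ) + y * Complex.I + 1))
    rw [him1] at b1
    rw [him2, abs_neg, abs_div, abs_of_pos hα0] at b2
    have e3 : (Real.pi * γ * ((c : ℂ) + y * Complex.I + 1)).im = Real.pi * γ * y := by
      rw [← Complex.ofReal_mul, Complex.im_ofReal_mul]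
      simp
    rw [e3, abs_mul, abs_of_pos (by positivity)] at b3
    rw [foxKernel_eq, norm_div, norm_mul, norm_mul, Complex.norm_real, Real.norm_of_nonneg hπ.le]
    have n1 := (norm_nonneg _).trans b1
    have n2 := (norm_nonneg _).trans b2
    calc _ ≤ C1 * Real.exp (-θ * |y|) * (C2 * Real.exp (-θ * (|y| / α))) *
          Real.exp (Real.pi * γ * |y|) / Real.pi := by gcongr
      _ = C1 * C2 / Real.pi * (Real.exp (-θ * |y|) * Real.exp (-θ * (|y| / α)) *
          Real.exp (Real.pi * γ * |y|)) := by ring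
      _ = _ := by
          rw [← Real.exp_add, ← Real.exp_add]
          congr 2
          ring

/-- Mellin inversion of the tail mean. Its value does not involve the line, hence all separating
lines give the same integral. -/
theorem hasFoxH_tail {ν : Measure ℝ} [IsProbabilityMeasure ν] {α φ γ z : ℝ} (hα1 : 1 < α)
    (hα2 : α ≤ 2) (hφ : |φ| < Real.pi / 2) (hγ : γ = 1 / 2 + φ / (α * Real.pi)) (hγ0 : 0 < γ)
    (hγα : γ ≤ 1 / α)
    (hν : ∀ t : ℝ, 0 < t → charFun ν t =
      Complex.exp (-(Complex.exp (-(φ * Complex.I)) * ((t ^ α : ℝ) : ℂ)))) (hz : 0 < z) :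
    HasFoxH 1 1 ![((1 - (α - 1) / α : ℝ) : ℂ), (γ : ℂ)] ![1 / α, γ] ![(0 : ℂ), (γ : ℂ)] ![1, γ]
      z ((∫ y in Set.Ioi z, y ∂ν : ℝ) : ℂ) := by
  have hα0 : 0 < α := by linarith
  have hb := norm_one_sub_charFun_le_rpow hφ hν
  have h1 := integrable_id_of_norm_one_sub_charFun_le hα1 hb
  have hna := nullSingletonClass_of_integrable_charFun (integrable_charFun_of_stable hα0 hφ hν)
  refine ⟨by norm_num, by norm_num, ?_, ?_, hz, ?_, fun c hc => ?_, fun c hc => ?_⟩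
  · intro j
    fin_cases j
    · simpa using hα0
    · simpa using hγ0
  · intro j
    fin_cases j
    · simp
    · simpa using hγ0
  · exact ⟨(α - 1) / 2, (foxSeparates_iff hα1).mpr ⟨by linarith, by linarith⟩⟩
  · rw [foxSeparates_iff hα1] at hc
    exact verticalIntegrable_foxKernel hα1 hγ0 hγα hc.1 hc.2
  · rw [foxSeparates_iff hα1] at hc
    have hV := verticalIntegrable_foxKernel hα1 hγ0 hγα hc.1 hc.2
    -- A moment of order strictly between `c + 1` and `α` is finite and makes the Mellin integral
    -- converge.
    obtain ⟨p, hp1, hp2⟩ := exists_between (show c + 1 < α by linarith [hc.2])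
    have hp := integrable_abs_rpow_of_norm_one_sub_charFun_le (by linarith [hc.1]) hp2 hb
    have hmel : ∀ y : ℝ, mellin (fun x : ℝ => ((∫ y in Set.Ioi x, y ∂ν : ℝ) : ℂ))
        ((c : ℂ) + y * Complex.I) = foxKernel 1 1 ![((1 - (α - 1) / α : ℝ) : ℂ), (γ : ℂ)]
          ![1 / α, γ] ![(0 : ℂ), (γ : ℂ)] ![1, γ] ((c : ℂ) + y * Complex.I) := fun y => by
      have hre : ((c : ℂ) + y * Complex.I).re = c := by simp
      set s : ℂ := (c : ℂ) + y * Complex.I with hs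
      have hs0 : s ≠ 0 := fun h => by
        rw [h, Complex.zero_re] at hre
        linarith [hc.1]
      have hα' : (α : ℂ) ≠ 0 := Complex.ofReal_ne_zero.mpr hα0.ne'
      rw [(mellinConvergent_tail_and_mellin_eq (by rw [hre]; exact hc.1) (by rw [hre]; exact hp1)
        hp h1).2, integral_pos_part_cpow hα2 hφ hν (by simp [hre, hc.1])
        (by simp [hre]; linarith [hc.2]), foxKernel_eq, Complex.Gamma_add_one s hs0, ← hγ,
        show (1 : ℂ) - (s + 1) / α = ((α - 1) / α : ℝ) - s / α by push_cast; field_simp; ring]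
      field_simp
    rw [← mellinInv_mellin_eq c (fun x : ℝ => ((∫ y in Set.Ioi x, y ∂ν : ℝ) : ℂ)) hz
      (mellinConvergent_tail_and_mellin_eq (by simpa using hc.1) (by simpa using hp1) hp h1).1
      (hV.congr (Eventually.of_forall fun y => (hmel y).symm))
      (Complex.continuous_ofReal.comp (continuous_integral_Ioi h1)).continuousAt]
    simp only [mellinInv, hmel]

/-! ### Quantiles, scaling and the tail conditional expectation -/

/-- Approaching the infimum from the left gives `≤ q`; the infimum lies in the closure of the set,
which gives `≥ q`. -/
theorem cdf_sInf_eq_of_continuous {μ : Measure ℝ} {q : ℝ} (hc : Continuous (cdf μ)) (hq0 : 0 < q)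
    (hq1 : q < 1) : cdf μ (sInf {x : ℝ | q < cdf μ x}) = q := by
  set A : Set ℝ := {x : ℝ | q < cdf μ x} with hA
  have hne : A.Nonempty := ((tendsto_cdf_atTop μ).eventually (lt_mem_nhds hq1)).exists
  have hbdd : BddBelow A := by
    obtain ⟨b, hb⟩ := ((tendsto_cdf_atBot μ).eventually (gt_mem_nhds hq0)).exists
    refine ⟨b, fun x (hx : q < cdf μ x) => ?_⟩
    by_contra! h
    exact absurd (monotone_cdf μ h.le) (not_le.mpr (hb.trans hx))
  refine le_antisymm ?_ ?_
  · refine le_of_tendsto ((hc.tendsto (sInf A)).mono_left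
      (nhdsWithin_le_nhds (s := Set.Iio (sInf A)))) ?_
    filter_upwards [self_mem_nhdsWithin] with x (hx : x < sInf A)
    by_contra! h
    exact absurd (csInf_le hbdd h) (not_le.mpr hx)
  · have hcl : closure A ⊆ {x | q ≤ cdf μ x} :=
      closure_minimal (fun x (hx : q < cdf μ x) => hx.le) (isClosed_le continuous_const hc)
    exact hcl (csInf_mem_closure hne hbdd)

/-- `tan(πα/2) = -tan(π - πα/2)` with `π - πα/2` in `[0, π/2)`, and `|β| ≤ 1` only shrinks the
argument of the monotone arctangent. The resulting bound is what yields `γ ≤ 1/α`. -/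
theorem abs_arctan_tan_mul_le {α β : ℝ} (hα1 : 1 < α) (hα2 : α ≤ 2) (hβ1 : -1 ≤ β) (hβ2 : β ≤ 1) :
    |Real.arctan (Real.tan (Real.pi * α / 2) * β)| ≤ Real.pi - Real.pi * α / 2 := by
  have hπ := Real.pi_pos
  have h0 : 0 ≤ Real.pi - Real.pi * α / 2 := by nlinarith
  have h1 : Real.pi - Real.pi * α / 2 < Real.pi / 2 := by nlinarith
  have ht : Real.tan (Real.pi * α / 2) = -Real.tan (Real.pi - Real.pi * α / 2) := by
    rw [Real.tan_pi_sub, neg_neg]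
  have hT : 0 ≤ Real.tan (Real.pi - Real.pi * α / 2) := Real.tan_nonneg_of_nonneg_of_le_pi_div_two
    h0 h1.le
  have hψ := Real.arctan_tan (x := Real.pi - Real.pi * α / 2) (by linarith) h1
  rw [abs_le, ← hψ, ← Real.arctan_neg, ht]
  constructor <;> refine Real.arctan_strictMono.monotone ?_ <;> nlinarith

theorem stableCharFun_div_eq {α σ β t : ℝ} (hα : 1 < α) (hσ : 0 < σ) (ht : 0 < t) :
    stableCharFun α σ β 0 ((σ * Real.sqrt (1 + (Real.tan (Real.pi * α / 2) * β) ^ 2) ^ (1 / α))⁻¹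
        * t) =
      Complex.exp (-(Complex.exp
        (-(Real.arctan (Real.tan (Real.pi * α / 2) * β) * Complex.I)) * ((t ^ α : ℝ) : ℂ))) := by
  set x : ℝ := Real.tan (Real.pi * α / 2) * β with hx
  set r : ℝ := Real.sqrt (1 + x ^ 2) with hr
  have hr0 : 0 < r := Real.sqrt_pos.mpr (by positivity)
  have hα0 : 0 < α := by linarith
  have hk : 0 < σ * r ^ (1 / α) := by positivity
  have htk : 0 < (σ * r ^ (1 / α))⁻¹ * t := by positivity
  rw [stableCharFun, if_neg hα.ne', Real.sign_of_pos htk]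
  have hpow : |σ * ((σ * r ^ (1 / α))⁻¹ * t)| ^ α = t ^ α / r := by
    rw [abs_of_pos (by positivity), show σ * ((σ * r ^ (1 / α))⁻¹ * t) = t / r ^ (1 / α) by
      field_simp, Real.div_rpow ht.le (by positivity), ← Real.rpow_mul hr0.le,
      one_div_mul_cancel hα0.ne', Real.rpow_one]
  have hexp : Complex.exp (-(Real.arctan x * Complex.I)) = (1 - Complex.I * x) / r := by
    rw [← neg_mul, Complex.exp_mul_I, Complex.cos_neg, Complex.sin_neg, ← Complex.ofReal_cos,
      ← Complex.ofReal_sin, Real.cos_arctan, Real.sin_arctan, ← hr]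
    push_cast
    ring
  rw [hpow, hexp]
  congr 1
  rw [hx]
  push_cast
  ring

section Tail

variable {Ω : Type*} [MeasurableSpace Ω] {P : Measure Ω} [IsProbabilityMeasure P] {S : Ω → ℝ}
  {k q : ℝ}

theorem setIntegral_Ioi_map_inv_mul {P : Measure Ω} (hS : Measurable S) (hk : 0 < k) (z : ℝ) :
    ∫ y in Set.Ioi (z / k), y ∂(P.map S).map (k⁻¹ * ·) = k⁻¹ * ∫ ω in {ω | z < S ω}, S ω ∂P := by
  rw [Measure.map_map (by fun_prop) hS,
    setIntegral_map measurableSet_Ioi (by fun_prop) (by fun_prop), ← integral_const_mul]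
  have : (((k⁻¹ * ·) ∘ S) ⁻¹' Set.Ioi (z / k)) = {ω | z < S ω} := by
    ext ω
    simp only [Set.mem_preimage, Function.comp_apply, Set.mem_Ioi, Set.mem_ofPred_eq]
    rw [inv_mul_eq_div, div_lt_div_iff_of_pos_right hk]
  rw [this]
  rfl

theorem cdf_map_eq_one_sub (hS : Measurable S) (hk : 0 < k) (z : ℝ) :
    cdf (P.map S) z = 1 - ((P.map S).map (k⁻¹ * ·)).real (Set.Ioi (z / k)) := by
  have hprob : IsProbabilityMeasure (P.map S) := Measure.isProbabilityMeasure_map hS.aemeasurable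
  rw [cdf_eq_real, map_measureReal_apply (by fun_prop) measurableSet_Ioi]
  have : (k⁻¹ * · : ℝ → ℝ) ⁻¹' Set.Ioi (z / k) = (Set.Iic z)ᶜ := by
    ext y
    simp only [Set.mem_preimage, Set.mem_Ioi, Set.mem_compl_iff, Set.mem_Iic, not_le]
    rw [inv_mul_eq_div, div_lt_div_iff_of_pos_right hk]
  rw [this, probReal_compl_eq_one_sub measurableSet_Iic]
  ring

theorem measure_valueAtRisk_lt (hS : Measurable S) (hc : Continuous (cdf (P.map S)))
    (hq0 : 0 < q) (hq1 : q < 1) :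
    P {ω | valueAtRisk P S q < S ω} = ENNReal.ofReal (1 - q) := by
  have hprob : IsProbabilityMeasure (P.map S) := Measure.isProbabilityMeasure_map hS.aemeasurable
  have h := cdf_sInf_eq_of_continuous hc hq0 hq1
  have e : {ω | valueAtRisk P S q < S ω} = S ⁻¹' (Set.Iic (valueAtRisk P S q))ᶜ := by
    ext ω
    simp
  rw [e, ← Measure.map_apply hS measurableSet_Iic.compl, ← ofReal_measureReal,
    probReal_compl_eq_one_sub measurableSet_Iic, ← cdf_eq_real, valueAtRisk, h]

end Tail

theorem mainTheorem1 {Ω : Type*} [MeasurableSpace Ω] (P : Measure Ω) [IsProbabilityMeasure P]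
    (S : Ω → ℝ) (hS : Measurable S)
    (α σ β q a r φ γ s_q : ℝ)
    (hα : 1 < α ∧ α ≤ 2) (hσ : 0 < σ) (hβ : -1 ≤ β ∧ β ≤ 1) (hq : 0 < q ∧ q < 1)
    (hstable : HasStableLaw P S α σ β 0)
    (ha : a = Real.tan (Real.pi * α / 2))
    (hr : r = Real.sqrt (1 + (a * β) ^ 2))
    (hφ : φ = Real.arctan (a * β))
    (hγ : γ = 1 / 2 + φ / (α * Real.pi))
    (hs : s_q = valueAtRisk P S q) (hs0 : 0 ≤ s_q)
    (H : ℝ → ℂ)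
    (hH : H = foxH 1 1 ![((1 - (α - 1) / α : ℝ) : ℂ), (γ : ℂ)] ![1 / α, γ]
      ![(0 : ℂ), (γ : ℂ)] ![1, γ]) :
    Integrable S (tailMeasure P S q) ∧
    (∀ z : ℝ, 0 < z → HasFoxH 1 1 ![((1 - (α - 1) / α : ℝ) : ℂ), (γ : ℂ)] ![1 / α, γ]
      ![(0 : ℂ), (γ : ℂ)] ![1, γ] z (H z)) ∧
    (0 < s_q → (tailCondExp P S q : ℂ) =
      ((σ * r ^ (1 / α) : ℝ) : ℂ) * H (s_q / (σ * r ^ (1 / α))) / ((1 - q : ℝ) : ℂ)) ∧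
    (s_q = 0 → ∃ h₀ : ℂ, Tendsto H (𝓝[>] 0) (𝓝 h₀) ∧
      (tailCondExp P S q : ℂ) = ((σ * r ^ (1 / α) : ℝ) : ℂ) * h₀ / ((1 - q : ℝ) : ℂ)) := by
  obtain ⟨hα1, hα2⟩ := hα
  obtain ⟨hq0, hq1⟩ := hq
  have hπ := Real.pi_pos
  have hα0 : 0 < α := by linarith
  have hφle : |φ| ≤ Real.pi - Real.pi * α / 2 := by
    rw [hφ, ha]
    exact abs_arctan_tan_mul_le hα1 hα2 hβ.1 hβ.2
  have hφlt : |φ| < Real.pi / 2 := hφle.trans_lt (by nlinarith)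
  have hγ0 : 0 < γ := by
    have h1 : -(1 / 2) < φ / (α * Real.pi) := by
      rw [lt_div_iff₀ (by positivity)]
      nlinarith [neg_abs_le φ]
    linarith
  have hγα : γ ≤ 1 / α := by
    have h1 : φ / (α * Real.pi) ≤ 1 / α - 1 / 2 := by
      rw [div_le_iff₀ (by positivity),
        show (1 / α - 1 / 2) * (α * Real.pi) = Real.pi - Real.pi * α / 2 by field_simp]
      exact (le_abs_self φ).trans hφle
    linarith
  have hr0 : 0 < r := by
    rw [hr]
    exact Real.sqrt_pos.mpr (by positivity)
  set k : ℝ := σ * r ^ (1 / α) with hk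
  have hk0 : 0 < k := by positivity
  have hprob : IsProbabilityMeasure (P.map S) := Measure.isProbabilityMeasure_map hS.aemeasurable
  set ν : Measure ℝ := (P.map S).map (k⁻¹ * ·) with hνdef
  have hprobν : IsProbabilityMeasure ν := Measure.isProbabilityMeasure_map (by fun_prop)
  have hν : ∀ t : ℝ, 0 < t → charFun ν t =
      Complex.exp (-(Complex.exp (-(φ * Complex.I)) * ((t ^ α : ℝ) : ℂ))) := fun t ht => by
    rw [hνdef, charFun_map_mul, hstable, hk, hr, hφ, ha, stableCharFun_div_eq hα1 hσ ht]
  have hint : Integrable (fun y : ℝ => y) ν :=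
    integrable_id_of_norm_one_sub_charFun_le hα1 (norm_one_sub_charFun_le_rpow hφlt hν)
  have hna := nullSingletonClass_of_integrable_charFun (integrable_charFun_of_stable hα0 hφlt hν)
  have hL := continuous_integral_Ioi hint
  -- The distribution function is one minus a tail integral of the constant `1`, so the continuity
  -- of tail integrals applies again.
  have hcdf : Continuous (cdf (P.map S)) := by
    have h1 : (fun x => cdf (P.map S) x) =
        fun x => 1 - ∫ _ in Set.Ioi (x / k), (1 : ℝ) ∂ν := by
      ext x
      rw [cdf_map_eq_one_sub hS hk0]
      simp [hνdef]
    change Continuous fun x => cdf (P.map S) x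
    rw [h1]
    exact continuous_const.sub
      ((continuous_integral_Ioi (integrable_const (1 : ℝ))).comp (continuous_id.div_const k))
  have hPA := measure_valueAtRisk_lt hS hcdf hq0 hq1
  have hSint : Integrable S P := by
    have h1 : Integrable (fun ω => k⁻¹ * S ω) P := by
      rw [hνdef, Measure.map_map (by fun_prop) hS] at hint
      exact (integrable_map_measure (f := (k⁻¹ * ·) ∘ S) (g := fun y : ℝ => y) (by fun_prop)
        ((measurable_const_mul k⁻¹).comp hS).aemeasurable).mp hint
    refine (h1.const_mul k).congr (Eventually.of_forall fun ω => ?_)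
    simp only
    field_simp
  have hH' : ∀ z : ℝ, 0 < z →
      HasFoxH 1 1 ![((1 - (α - 1) / α : ℝ) : ℂ), (γ : ℂ)] ![1 / α, γ] ![(0 : ℂ), (γ : ℂ)] ![1, γ]
        z ((∫ y in Set.Ioi z, y ∂ν : ℝ) : ℂ) := fun z hz =>
    hasFoxH_tail hα1 hα2 hφlt hγ hγ0 hγα hν hz
  have hHz : ∀ z : ℝ, 0 < z → H z = ((∫ y in Set.Ioi z, y ∂ν : ℝ) : ℂ) := fun z hz => by
    rw [hH]
    exact (hH' z hz).foxH_eq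
  have hT : (tailCondExp P S q : ℂ) =
      (k : ℂ) * ((∫ y in Set.Ioi (s_q / k), y ∂ν : ℝ) : ℂ) / ((1 - q : ℝ) : ℂ) := by
    rw [setIntegral_Ioi_map_inv_mul hS hk0, tailCondExp, tailMeasure, ProbabilityTheory.cond,
      integral_smul_measure, hPA, ENNReal.toReal_inv, ENNReal.toReal_ofReal (by linarith), ← hs,
      ← Complex.ofReal_mul, ← Complex.ofReal_div, smul_eq_mul]
    congr 1
    field_simp
  refine ⟨?_, fun z hz => ?_, fun hpos => ?_, fun hzero => ?_⟩
  · rw [tailMeasure, ProbabilityTheory.cond]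
    refine hSint.restrict.smul_measure ?_
    rw [hPA]
    simp [hq1]
  · rw [hHz z hz]
    exact hH' z hz
  · rw [hT, hHz _ (div_pos hpos hk0)]
  -- `H` agrees with the tail mean only for `z > 0`; the limit at `0` is read off from the
  -- continuity of the tail mean.
  · refine ⟨((∫ y in Set.Ioi 0, y ∂ν : ℝ) : ℂ), ?_, by rw [hT, hzero, zero_div]⟩
    refine Tendsto.congr' ?_ (((Complex.continuous_ofReal.comp hL).tendsto 0).mono_left
      nhdsWithin_le_nhds)
    filter_upwards [self_mem_nhdsWithin] with z hz
    exact (hHz z hz).symm
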